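/- **Setting.** Let $m,N\ge 1$. For $i=1,\dots,m$ let $X_i\subseteq\mathbb R^N$ be an (embedded) $C^2$ submanifold of dimension $d_i$, let $\mathbf X=X_1\times\dots\times X_m$, let $c:\mathbf X\to\mathbb R$ be of class $C^2$, and let $\mu_i$ be a Borel probability measure on $X_i$ that is concentrated on a compact subset of $X_i$ and has a density in $L^\infty$ with respect to the $d_i$-dimensional Hausdorff measure $\mathcal H^{d_i}$ on $X_i$. Let $\Pi(\mu_1,\dots,\mu_m)$ be the set of probability measures on $\mathbf X$ with marginals $\mu_1,\dots,\mu_m$ and, for $\varepsilon>0$, $$\mathsf{MOT}_0=\inf_{\gamma\in\Pi(\mu_1,\dots,\mu_m)}\int_{\mathbf X} c\,d\gamma,\qquad \mathsf{MOT}_\varepsilon=\inf_{\gamma\in\Pi(\mu_1,\dots,\mu_m)}\Big\{\int_{\mathbf X} c\,d\gamma+\varepsilon\,\mathrm{Ent}(\gamma\,|\,\mu_1\otimes\dots\otimes\mu_m)\Big\},$$ where $\mathrm{Ent}(\gamma\,|\,q)=\int\rho\log\rho\,dq$ if $\gamma=\rho q$, and $+\infty$ otherwise. For every partition $p=\{p_-,p_+\}$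 of $\{1,\dots,m\}$ into two nonempty sets, let $g_p$ be the symmetric bilinear form on $T\mathbf X$ $$g_p=D^2_{p_-p_+}c+D^2_{p_+p_-}c,\qquad D^2_{pq}c=\sum_{i\in p,\,j\in q}D^2_{x_ix_j}c,$$ where $D^2_{x_ix_j}c=\sum_{\alpha,\beta}\frac{\partial^2c}{\partial x_i^\alpha\partial x_j^\beta}\,dx_i^\alpha\otimes dx_j^\beta$ for $i\neq j$ in local $C^2$ coordinates on $X_i$ and $X_j$, and let $G_c=\{\sum_p t_p\,g_p : t_p\ge 0,\ \sum_p t_p=1\}$ be the convex hull of the $g_p$. **Proposition (lower bound under the signature condition $\mathrm{PS}(\kappa)$).** Let $\kappa\in\mathbb N$ and suppose that for every $\mathbf x\in\mathbf X$ there is $g\in G_c$ such that $g(\mathbf x)$ has at least $\kappa$ positive eigenvalues (counted with multiplicity, in local coordinates). Then there is a constant $C_*\in[0,\infty)$ such that for every $\varepsilon>0$ $$\mathsf{MOT}_\varepsilon\ \ge\ \mathsf{MOT}_0+\frac{\kappa}{2}\,\varepsilon\log(1/\varepsilon)-C_*\,\varepsilon .$$ **Two marginals.** In particular, if $m=2$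 and $D^2_{x_1x_2}c(\mathbf x)$ has rank at least $r$ at every $\mathbf x\in\mathbf X$ (the cost may be degenerate), then the signature condition $\mathrm{PS}(\kappa)$ above holds with $\kappa=r$, and so there is $C_*\in[0,\infty)$ such that $\mathsf{MOT}_\varepsilon\ge\mathsf{MOT}_0+\frac r2\,\varepsilon\log(1/\varepsilon)-C_*\,\varepsilon$ for every $\varepsilon>0$. -/

import Mathlib

open MeasureTheory

/-- The Euclidean space `ℝⁿ`. -/
abbrev Euc (n : ℕ) : Type := EuclideanSpace ℝ (Fin n)

/-- `ψ` is a local chart of class `C²` of `X ⊆ ℝᴺ`: a homeomorphism between a relatively open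
subset of `X` and an open subset of `ℝᵈ` whose inverse, seen as a map into `ℝᴺ`, is a `C²`
immersion. -/
def IsC2Chart {N d : ℕ} (X : Set (Euc N)) (ψ : OpenPartialHomeomorph X (Euc d)) : Prop :=
  ContDiffOn ℝ 2 (fun y => (ψ.symm y : Euc N)) ψ.target ∧
    ∀ y ∈ ψ.target, Function.Injective (fderiv ℝ (fun z => (ψ.symm z : Euc N)) y)

/-- `X` is an (embedded) `d`-dimensional submanifold of `ℝᴺ` of class `C²`. -/
def IsC2Submanifold {N : ℕ} (X : Set (Euc N)) (d : ℕ) : Prop :=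
  ∀ x : X, ∃ ψ : OpenPartialHomeomorph X (Euc d), IsC2Chart X ψ ∧ x ∈ ψ.source

section Cost

variable {m N : ℕ} {X : Fin m → Set (Euc N)} {d : Fin m → ℕ}

/-- The function `c` on `X₁ × ⋯ × X_m` read in the charts `ψ₁, …, ψ_m`. -/
def inCharts (c : (∀ i, X i) → ℝ) (ψ : ∀ i, OpenPartialHomeomorph (X i) (Euc (d i))) :
    (∀ i, Euc (d i)) → ℝ :=
  fun y => c fun i => (ψ i).symm (y i)

/-- `c` is a function of class `C²` on `X₁ × ⋯ × X_m`, where `X i` is a submanifold of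
dimension `d i`: it is `C²` when read in any local charts. -/
def IsC2Cost (d : Fin m → ℕ) (c : (∀ i, X i) → ℝ) : Prop :=
  ∀ ψ : ∀ i, OpenPartialHomeomorph (X i) (Euc (d i)), (∀ i, IsC2Chart (X i) (ψ i)) →
    ContDiffOn ℝ 2 (inCharts c ψ) (Set.univ.pi fun i => (ψ i).target)

/-- The matrix of `D²_{x_i x_j} c` at `x` in the charts `ψ`. -/
noncomputable def mixedHessian (c : (∀ i, X i) → ℝ)
    (ψ : ∀ i, OpenPartialHomeomorph (X i) (Euc (d i))) (x : ∀ i, X i) (i j : Fin m) :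
    Matrix (Fin (d i)) (Fin (d j)) ℝ :=
  Matrix.of fun a b => iteratedFDeriv ℝ 2 (inCharts c ψ) (fun k => ψ k (x k))
    ![Pi.single i (EuclideanSpace.single a 1), Pi.single j (EuclideanSpace.single b 1)]

/-- The matrix, on `T_{x₁}X₁ × ⋯ × T_{x_m}X_m` in the coordinates given by the charts `ψ`, of
`D²_{p q} c = ∑_{i ∈ p, j ∈ q} D²_{x_i x_j} c`. -/
noncomputable def blockHessian (c : (∀ i, X i) → ℝ)
    (ψ : ∀ i, OpenPartialHomeomorph (X i) (Euc (d i))) (x : ∀ i, X i) (p q : Finset (Fin m)) :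
    Matrix (Σ i, Fin (d i)) (Σ i, Fin (d i)) ℝ :=
  Matrix.of fun α β =>
    if α.1 ∈ p ∧ β.1 ∈ q then mixedHessian c ψ x α.1 β.1 α.2 β.2 else 0

/-- The matrix at `x` of the form `g_p = D²_{p₋ p₊} c + D²_{p₊ p₋} c` associated with the
partition `{p, pᶜ}`. -/
noncomputable def passForm (c : (∀ i, X i) → ℝ)
    (ψ : ∀ i, OpenPartialHomeomorph (X i) (Euc (d i))) (x : ∀ i, X i) (p : Finset (Fin m)) :
    Matrix (Σ i, Fin (d i)) (Σ i, Fin (d i)) ℝ :=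
  blockHessian c ψ x p pᶜ + blockHessian c ψ x pᶜ p

/-- The values at `x` of the elements of `G_c`: the convex hull of the forms `g_p`, over the
partitions of `{1, …, m}` into two nonempty sets. -/
noncomputable def passHull (c : (∀ i, X i) → ℝ)
    (ψ : ∀ i, OpenPartialHomeomorph (X i) (Euc (d i))) (x : ∀ i, X i) :
    Set (Matrix (Σ i, Fin (d i)) (Σ i, Fin (d i)) ℝ) :=
  convexHull ℝ {g | ∃ p : Finset (Fin m), p.Nonempty ∧ pᶜ.Nonempty ∧ g = passForm c ψ x p}

/-- The number of positive eigenvalues, with multiplicity, of a (symmetric) real matrix. -/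
noncomputable def posEigenvalues {ι : Type*} [Fintype ι] [DecidableEq ι] (A : Matrix ι ι ℝ) : ℕ :=
  (A.charpoly.roots.filter fun t => 0 < t).card

/-- The signature condition `PS(κ)`: at every point some element of `G_c` has at least `κ`
positive eigenvalues. By Sylvester's law of inertia the choice of the charts is immaterial. -/
def PosSignature (d : Fin m → ℕ) (c : (∀ i, X i) → ℝ) (κ : ℕ) : Prop :=
  ∀ x : ∀ i, X i, ∃ ψ : ∀ i, OpenPartialHomeomorph (X i) (Euc (d i)),
    (∀ i, IsC2Chart (X i) (ψ i) ∧ x i ∈ (ψ i).source) ∧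
      ∃ g ∈ passHull c ψ x, κ ≤ posEigenvalues g

end Cost

/-- `μ` has a density in `L^∞` with respect to `ν`. -/
def HasBoundedDensity {α : Type*} [MeasurableSpace α] (μ ν : Measure α) : Prop :=
  ∃ f : α → ENNReal, Measurable f ∧ essSup f ν < ⊤ ∧ μ = ν.withDensity f

section Transport

variable {m : ℕ} {Y : Fin m → Type*} [∀ i, MeasurableSpace (Y i)]

/-- `Π(μ₁, …, μ_m)`: the probability measures with marginals `μ₁, …, μ_m`. -/
def Plans (μ : ∀ i, Measure (Y i)) : Set (Measure (∀ i, Y i)) :=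
  {γ | IsProbabilityMeasure γ ∧ ∀ i, γ.map (fun x => x i) = μ i}

/-- The multi-marginal optimal transport cost `MOT₀`. It is used only for costs that are
integrable against every plan (continuous costs and compactly supported marginals). -/
noncomputable def MOT (μ : ∀ i, Measure (Y i)) (c : (∀ i, Y i) → ℝ) : EReal :=
  ⨅ γ ∈ Plans μ, ((∫ x, c x ∂γ : ℝ) : EReal)

/-- The entropic multi-marginal optimal transport cost `MOT_ε`, for `ε > 0`; `klDiv γ q` is the
relative entropy `Ent(γ | q)`, which is `∞` unless `γ` has a density `ρ` with respect to `q`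
with `ρ log ρ` integrable. -/
noncomputable def entropicMOT (ε : ℝ) (μ : ∀ i, Measure (Y i)) (c : (∀ i, Y i) → ℝ) : EReal :=
  ⨅ γ ∈ Plans μ, (((∫ x, c x ∂γ : ℝ) : EReal) +
    ((ENNReal.ofReal ε * InformationTheory.klDiv γ (Measure.pi μ) : ENNReal) : EReal))

end Transport

/-! Let `a + ⊕φᵢ ≤ c` on the product of compact sets `Kᵢ` carrying the `μᵢ`, and let `E = c - a -
⊕φᵢ` be the gap. The Gibbs variational inequality bounds the entropic cost of every plan from below
by `a + ∑ ∫ φᵢ dμᵢ - ε log ∫ exp(-E/ε) d⊗μᵢ`. Kantorovich duality provides potentials with `a + ∑ ∫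
φᵢ dμᵢ ≥ MOT₀ - ε`, so it suffices to bound the Laplace integral by `B ε^(κ/2)` with `B` independent
of the potentials (`MOT_add_le_entropicMOT`).

The potentials are merely measurable; a swapping argument replaces regularity. Exchanging between
`y` and `y + h` the coordinates indexed by `p` leaves the total of the potentials unchanged, and `E
≥ 0` at the two new points. Hence `E(y) + E(y + h)` is at least a second difference of `c`, which is
`g_p(h, h) / 2` up to a small multiple of `‖h‖²`. Averaging over `p` gives the same for any `g ∈
G_c`, so `E(y) + E(y + Tu) ≥ λ‖u‖²` for an injective linear `T` on `ℝ^κ` (`exists_gap_coercive`).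

On a slice parallel to the range of `T`, comparison with a near-minimiser of `E` dominates
`exp(-E/ε)` by a Gaussian of mass `O(ε^(κ/2))`. Integrating over the bounded transverse directions
(`exists_lintegral_exp_neg_le`), dominating the `μᵢ` by Lebesgue measure in charts
(`IsC2Chart.exists_restrict_le`) and covering the compact set by finitely many charts gives the
bound.

For two marginals with `B = D²_{x₁x₂}c`, the form is positive on the vectors `(Bw, w)`, with `w ≠ 0`
in a complement of `ker B`. -/

/-! ### Elementary properties of transport plans -/

section Duality

variable {m : ℕ} {Y : Fin m → Type*} [∀ i, MeasurableSpace (Y i)]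

/-- The product measure is a transport plan. -/
lemma pi_mem_Plans (μ : ∀ i, Measure (Y i)) [∀ i, IsProbabilityMeasure (μ i)] :
    Measure.pi μ ∈ Plans μ :=
  ⟨inferInstance, fun i => (measurePreserving_eval μ i).map_eq⟩

lemma integral_eval_of_mem_Plans {μ : ∀ i, Measure (Y i)} {γ : Measure (∀ i, Y i)}
    (hγ : γ ∈ Plans μ) (i : Fin m) {f : Y i → ℝ} (hf : Measurable f) :
    ∫ x, f (x i) ∂γ = ∫ y, f y ∂(μ i) := by
  rw [← hγ.2 i, integral_map (measurable_pi_apply i).aemeasurable hf.aestronglyMeasurable]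

/-- Separable functions have the same integral against every plan, the source of weak duality. -/
lemma integral_sum_of_mem_Plans {μ : ∀ i, Measure (Y i)} {γ : Measure (∀ i, Y i)}
    (hγ : γ ∈ Plans μ) (a : ℝ) {f : ∀ i, Y i → ℝ} (hf : ∀ i, Measurable (f i))
    (hfi : ∀ i, Integrable (f i) (μ i)) :
    Integrable (fun x : ∀ i, Y i => a + ∑ i, f i (x i)) γ ∧
      ∫ x, (a + ∑ i, f i (x i)) ∂γ = a + ∑ i, ∫ y, f i y ∂(μ i) := by
  have := hγ.1
  have h1 : ∀ i, Integrable (fun x : ∀ i, Y i => f i (x i)) γ := fun i => by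
    have h := hfi i
    rw [← hγ.2 i] at h
    exact h.comp_measurable (measurable_pi_apply i)
  refine ⟨(integrable_const a).add (integrable_finsetSum _ fun i _ => h1 i), ?_⟩
  rw [integral_add (integrable_const a) (integrable_finsetSum _ fun i _ => h1 i),
    integral_finsetSum _ fun i _ => h1 i]
  simp [integral_eval_of_mem_Plans hγ _ (hf _)]

lemma ae_mem_of_mem_Plans {μ : ∀ i, Measure (Y i)} {K : ∀ i, Set (Y i)}
    (hμK : ∀ i, μ i (K i)ᶜ = 0)
    {γ : Measure (∀ i, Y i)} (hγ : γ ∈ Plans μ) : ∀ᵐ x ∂γ, x ∈ Set.univ.pi K := by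
  have : ∀ i, ∀ᵐ x ∂γ, x i ∈ K i := fun i => by
    have h : ∀ᵐ y ∂(γ.map fun x => x i), y ∈ K i := by
      rw [hγ.2 i]
      exact hμK i
    exact ae_of_ae_map (measurable_pi_apply i).aemeasurable h
  filter_upwards [ae_all_iff.2 this] with x hx i _ using hx i

end Duality

/-! ### Kantorovich duality on compact spaces, by Hahn–Banach and Riesz -/

section CompactDuality

variable {m : ℕ} {Y : Fin m → Type*} [∀ i, MetricSpace (Y i)] [∀ i, CompactSpace (Y i)]
  [∀ i, MeasurableSpace (Y i)]

/-- The values `a + ∑ᵢ ∫ φᵢ dμᵢ` of the separable majorants `a + ⊕ᵢ φᵢ` of `f`. -/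
def majorantValues (μ : ∀ i, Measure (Y i)) (f : C(∀ i, Y i, ℝ)) : Set ℝ :=
  {t | ∃ (a : ℝ) (φ : ∀ i, C(Y i, ℝ)), (∀ y, f y ≤ a + ∑ i, φ i (y i)) ∧
    t = a + ∑ i, ∫ y, φ i y ∂(μ i)}

lemma majorantValues_nonempty (μ : ∀ i, Measure (Y i)) (f : C(∀ i, Y i, ℝ)) : (majorantValues μ f).Nonempty :=
  ⟨_, ‖f‖, 0, fun y => by simpa using (le_abs_self _).trans (f.norm_coe_le_norm y), rfl⟩

variable [∀ i, BorelSpace (Y i)] (μ : ∀ i, Measure (Y i)) [∀ i, IsProbabilityMeasure (μ i)]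

/-- Testing against the product plan keeps the majorant values bounded below, so their infimum is
meaningful. -/
lemma integral_le_of_mem_majorantValues {f : C(∀ i, Y i, ℝ)} {t : ℝ}
    (ht : t ∈ majorantValues μ f) : ∫ y, f y ∂(Measure.pi μ) ≤ t := by
  obtain ⟨a, φ, h, rfl⟩ := ht
  have hc : ∀ i, Integrable (φ i) (μ i) := fun i =>
    (φ i).continuous.integrable_of_hasCompactSupport (HasCompactSupport.of_compactSpace _)
  obtain ⟨h1, h2⟩ := integral_sum_of_mem_Plans (pi_mem_Plans μ) a
    (fun i => (φ i).continuous.measurable) hc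
  rw [← h2]
  exact integral_mono
    (f.continuous.integrable_of_hasCompactSupport (HasCompactSupport.of_compactSpace _)) h1 h

lemma majorantValues_bddBelow (f : C(∀ i, Y i, ℝ)) : BddBelow (majorantValues μ f) :=
  ⟨_, fun _ ht => integral_le_of_mem_majorantValues μ ht⟩

/-- Together with positive homogeneity, this is the sublinearity required by Hahn–Banach. -/
lemma sInf_majorantValues_add (f g : C(∀ i, Y i, ℝ)) :
    sInf (majorantValues μ (f + g)) ≤ sInf (majorantValues μ f) + sInf (majorantValues μ g) := by
  refine le_of_forall_pos_le_add fun δ hδ => ?_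
  obtain ⟨_, ⟨a, φ, h, rfl⟩, hs⟩ := Real.lt_sInf_add_pos (majorantValues_nonempty μ f) (half_pos hδ)
  obtain ⟨_, ⟨b, χ, k, rfl⟩, hs'⟩ :=
    Real.lt_sInf_add_pos (majorantValues_nonempty μ g) (half_pos hδ)
  refine (csInf_le (majorantValues_bddBelow μ _) ⟨a + b, fun i => φ i + χ i, fun y => ?_, rfl⟩).trans
    ?_
  · have := h y
    have := k y
    simp only [ContinuousMap.add_apply, Finset.sum_add_distrib]
    linarith
  · have : ∀ i, ∫ y, (φ i + χ i) y ∂(μ i) = ∫ y, φ i y ∂(μ i) + ∫ y, χ i y ∂(μ i) := fun i =>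
      integral_add
        ((φ i).continuous.integrable_of_hasCompactSupport (HasCompactSupport.of_compactSpace _))
        ((χ i).continuous.integrable_of_hasCompactSupport (HasCompactSupport.of_compactSpace _))
    simp only [this, Finset.sum_add_distrib]
    linarith

lemma sInf_majorantValues_smul_le {r : ℝ} (hr : 0 < r) (f : C(∀ i, Y i, ℝ)) :
    sInf (majorantValues μ (r • f)) ≤ r * sInf (majorantValues μ f) := by
  refine le_of_forall_pos_le_add fun δ hδ => ?_
  obtain ⟨_, ⟨a, φ, h, rfl⟩, hs⟩ :=
    Real.lt_sInf_add_pos (majorantValues_nonempty μ f) (div_pos hδ hr)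
  refine (csInf_le (majorantValues_bddBelow μ _) ⟨r * a, fun i => r • φ i, fun y => ?_, rfl⟩).trans
    ?_
  · have := mul_le_mul_of_nonneg_left (h y) hr.le
    simpa [mul_add, Finset.mul_sum] using this
  · have : ∀ i, ∫ y, (r • φ i) y ∂(μ i) = r * ∫ y, φ i y ∂(μ i) := fun i =>
      integral_const_mul _ _
    simp only [this, ← Finset.mul_sum, ← mul_add]
    have := mul_le_mul_of_nonneg_left hs.le hr.le
    rwa [mul_add r (sInf _), mul_div_cancel₀ _ hr.ne'] at this

lemma sInf_majorantValues_smul {r : ℝ} (hr : 0 < r) (f : C(∀ i, Y i, ℝ)) :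
    sInf (majorantValues μ (r • f)) = r * sInf (majorantValues μ f) := by
  refine le_antisymm (sInf_majorantValues_smul_le μ hr f) ?_
  have := sInf_majorantValues_smul_le μ (inv_pos.2 hr) (r • f)
  rw [smul_smul, inv_mul_cancel₀ hr.ne', one_smul] at this
  have := mul_le_mul_of_nonneg_left this hr.le
  rwa [← mul_assoc, mul_inv_cancel₀ hr.ne', one_mul] at this

/-- The Riesz representation theorem for a positive functional on the continuous functions of a
compact space. -/
lemma exists_measure_of_positive {Z : Type*} [TopologicalSpace Z] [T2Space Z] [CompactSpace Z]
    [MeasurableSpace Z] [BorelSpace Z] (L : C(Z, ℝ) →ₗ[ℝ] ℝ) (hL : ∀ f, 0 ≤ f → 0 ≤ L f) :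
    ∃ γ : Measure Z, IsFiniteMeasure γ ∧ ∀ f : C(Z, ℝ), ∫ z, f z ∂γ = L f := by
  let Λ : CompactlySupportedContinuousMap Z ℝ →ₚ[ℝ] ℝ :=
    PositiveLinearMap.mk₀ (
      { toFun := fun f => L f.toContinuousMap
        map_add' := fun f g => L.map_add f.toContinuousMap g.toContinuousMap
        map_smul' := fun r f => L.map_smul r f.toContinuousMap } :
        CompactlySupportedContinuousMap Z ℝ →ₗ[ℝ] ℝ) fun f hf => hL _ hf
  refine ⟨RealRMK.rieszMeasure Λ, inferInstance, fun f => ?_⟩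
  exact RealRMK.integral_rieszMeasure Λ ⟨f, HasCompactSupport.of_compactSpace _⟩

/-- Kantorovich duality on compact spaces: there is no duality gap. -/
theorem exists_plan_potentials_of_compact (c : C(∀ i, Y i, ℝ)) {ε : ℝ} (hε : 0 < ε) :
    ∃ γ ∈ Plans μ, ∃ (a : ℝ) (φ : ∀ i, C(Y i, ℝ)), (∀ y, a + ∑ i, φ i (y i) ≤ c y) ∧
      ∫ y, c y ∂γ ≤ a + ∑ i, ∫ y, φ i y ∂(μ i) + ε := by
  -- The functional prescribed on the line through `-c` needs a nonzero generator.
  by_cases hc : -c = 0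
  · refine ⟨_, pi_mem_Plans μ, 0, 0, ?_, ?_⟩
    · simp [neg_eq_zero.1 hc]
    · simpa [neg_eq_zero.1 hc] using hε.le
  set p : C(∀ i, Y i, ℝ) → ℝ := fun f => sInf (majorantValues μ f) with hp
  have p_zero : p 0 = 0 := by
    have := sInf_majorantValues_smul μ (r := 2) two_pos 0
    rw [smul_zero] at this
    change p 0 = 2 * p 0 at this
    linarith
  obtain ⟨L, hLe, hLp⟩ := exists_extension_of_le_sublinear
    (LinearPMap.mkSpanSingleton (-c) (p (-c)) hc) p
    (fun r hr f => sInf_majorantValues_smul μ hr f) (sInf_majorantValues_add μ) (by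
      rintro ⟨x, hx⟩
      obtain ⟨t, rfl⟩ := Submodule.mem_span_singleton.1 hx
      rw [LinearPMap.mkSpanSingleton'_apply]
      change t * p (-c) ≤ p (t • (-c))
      rcases lt_trichotomy t 0 with ht | rfl | ht
      -- For negative `t`, subadditivity applied to two opposite vectors gives domination by `p`.
      · have h1 := sInf_majorantValues_add μ (t • (-c)) ((-t) • (-c))
        rw [sInf_majorantValues_smul μ (neg_pos.2 ht), ← add_smul, add_neg_cancel, zero_smul] at h1
        change p 0 ≤ p (t • (-c)) + (-t) * p (-c) at h1
        linarith
      · simp [p_zero]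
      · exact (sInf_majorantValues_smul μ ht (-c)).ge)
  have hLc : L (-c) = p (-c) := by
    have := hLe ⟨-c, Submodule.mem_span_singleton_self _⟩
    rw [this]
    exact LinearPMap.mkSpanSingleton_apply ℝ ℝ hc _
  have hle : ∀ (f : C(∀ i, Y i, ℝ)) (a : ℝ) (φ : ∀ i, C(Y i, ℝ)),
      (∀ y, f y ≤ a + ∑ i, φ i (y i)) → L f ≤ a + ∑ i, ∫ y, φ i y ∂(μ i) := fun f a φ h =>
    (hLp f).trans (csInf_le (majorantValues_bddBelow μ f) ⟨a, φ, h, rfl⟩)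
  -- If `f ≥ 0`, then zero majorises `-f`, so `L (-f) ≤ 0`.
  obtain ⟨γ, hγ, hγL⟩ := exists_measure_of_positive L fun f hf => by
    have := hle (-f) 0 0 fun y => by simpa using hf y
    rw [map_neg] at this
    simp at this
    linarith
  -- The free constant `a` lets `1` and `-1` majorise themselves; this also works when `m = 0`.
  have hγ1 : IsProbabilityMeasure γ := by
    have h1 := hle 1 1 0 fun y => by simp
    have h2 := hle (-1) (-1) 0 fun y => by simp
    rw [map_neg] at h2
    have h3 : L 1 = 1 := by
      simp at h1 h2
      linarith
    have h4 := hγL 1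
    rw [h3] at h4
    simp [measureReal_def] at h4
    exact ⟨by rw [← ENNReal.ofReal_toReal (measure_ne_top γ _), h4, ENNReal.ofReal_one]⟩
  have hmarg : ∀ i, γ.map (fun x => x i) = μ i := fun i => by
    have : IsFiniteMeasure (γ.map fun x => x i) := inferInstance
    refine ext_of_forall_integral_eq_of_IsFiniteMeasure fun f => ?_
    -- A function of one coordinate is its own separable majorant; using `g` and `-g` turns the
    -- inequality into equality.
    have key : ∀ g : C(Y i, ℝ), L (g.comp ⟨fun y => y i, continuous_apply i⟩) ≤ ∫ y, g y ∂(μ i) := by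
      intro g
      have := hle (g.comp ⟨fun y => y i, continuous_apply i⟩) 0 (Pi.single i g) fun y => by
        rw [Finset.sum_eq_single i]
        · simp
        · intro j _ hj
          simp [Pi.single_eq_of_ne hj]
        · simp
      refine this.trans_eq ?_
      rw [Finset.sum_eq_single i]
      · simp
      · intro j _ hj
        simp [Pi.single_eq_of_ne hj]
      · simp
    rw [integral_map (measurable_pi_apply i).aemeasurable f.continuous.aestronglyMeasurable]
    have h0 := hγL (f.toContinuousMap.comp ⟨fun y => y i, continuous_apply i⟩)
    have h1 := key f.toContinuousMap
    have h2 := key (-f.toContinuousMap)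
    rw [ContinuousMap.neg_comp, map_neg] at h2
    simp only [ContinuousMap.neg_apply, integral_neg] at h2
    exact h0.trans (le_antisymm h1 (by simpa using h2))
  -- Since `L (-c) = p (-c)`, negating a near-optimal majorant of `-c` gives a minorant of `c` with
  -- gap at most `ε`.
  obtain ⟨_, ⟨a, φ, h, rfl⟩, hs⟩ := Real.lt_sInf_add_pos (majorantValues_nonempty μ (-c)) hε
  refine ⟨γ, ⟨hγ1, hmarg⟩, -a, fun i => -φ i, fun y => ?_, ?_⟩
  · have := h y
    simp at this ⊢
    linarith
  · have h1 := hγL (-c)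
    rw [hLc] at h1
    simp only [ContinuousMap.neg_apply, integral_neg, Finset.sum_neg_distrib] at h1 ⊢
    change _ < p (-c) + ε at hs
    linarith

end CompactDuality

/-! ### Duality for marginals carried by compact sets -/

section NoncompactDuality

variable {m : ℕ} {X : Fin m → Type*} [∀ i, MetricSpace (X i)] [∀ i, MeasurableSpace (X i)]
  [∀ i, BorelSpace (X i)] [∀ i, SecondCountableTopology (X i)]

/-- Kantorovich duality for compactly supported marginals and a continuous cost. -/
theorem exists_plan_potentials (μ : ∀ i, Measure (X i)) [∀ i, IsProbabilityMeasure (μ i)]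
    {K : ∀ i, Set (X i)} (hK : ∀ i, IsCompact (K i)) (hμK : ∀ i, μ i (K i)ᶜ = 0)
    {c : (∀ i, X i) → ℝ} (hc : Continuous c) {ε : ℝ} (hε : 0 < ε) :
    ∃ γ ∈ Plans μ, ∃ (a : ℝ) (φ : ∀ i, X i → ℝ), (∀ i, Measurable (φ i)) ∧
      (∀ i, Integrable (φ i) (μ i)) ∧
      (∀ x, (∀ i, x i ∈ K i) → a + ∑ i, φ i (x i) ≤ c x) ∧
      ∫ x, c x ∂γ ≤ a + ∑ i, ∫ y, φ i y ∂(μ i) + ε := by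
  have hKm : ∀ i, MeasurableSet (K i) := fun i => (hK i).measurableSet
  have : ∀ i, CompactSpace (K i) := fun i => isCompact_iff_compactSpace.1 (hK i)
  let ν : ∀ i, Measure (K i) := fun i => (μ i).comap Subtype.val
  have hν : ∀ i, (ν i).map Subtype.val = μ i := fun i => by
    rw [map_comap_subtype_coe (hKm i), Measure.restrict_eq_self_of_ae_mem]
    exact hμK i
  have : ∀ i, IsProbabilityMeasure (ν i) := fun i => ⟨by
    rw [← measure_univ (μ := μ i), ← hν i,
      Measure.map_apply measurable_subtype_coe MeasurableSet.univ, Set.preimage_univ]⟩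
  let J : (∀ i, K i) → ∀ i, X i := fun y i => y i
  have hJ : Continuous J := by fun_prop
  obtain ⟨γ, hγ, a, φ, h1, h2⟩ :=
    exists_plan_potentials_of_compact ν (⟨fun y => c (J y), hc.comp hJ⟩ : C(∀ i, K i, ℝ)) hε
  have := hγ.1
  have hemb : ∀ i, MeasurableEmbedding (Subtype.val : K i → X i) := fun i =>
    MeasurableEmbedding.subtype_coe (hKm i)
  -- Extension by zero preserves measurability, and the minorant inequality is needed only on the
  -- product of the `K i`.
  let χ : ∀ i, X i → ℝ := fun i => Function.extend Subtype.val (φ i) fun _ => 0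
  have hχ : ∀ i (y : K i), χ i y = φ i y := fun i y => Subtype.val_injective.extend_apply _ _ _
  have hχm : ∀ i, Measurable (χ i) := fun i =>
    (hemb i).measurable_extend (φ i).continuous.measurable measurable_const
  refine ⟨γ.map J, ⟨Measure.isProbabilityMeasure_map hJ.measurable.aemeasurable, fun i => ?_⟩, a,
    χ, hχm, fun i => ?_, fun x hx => ?_, ?_⟩
  · rw [Measure.map_map (measurable_pi_apply i) hJ.measurable, ← hν i, ← hγ.2 i,
      Measure.map_map measurable_subtype_coe (measurable_pi_apply i)]
    rfl
  · rw [← hν i, (hemb i).integrable_map_iff]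
    refine ((φ i).continuous.integrable_of_hasCompactSupport
      (HasCompactSupport.of_compactSpace _)).congr (ae_of_all _ fun y => (hχ i y).symm)
  · have := h1 fun i => ⟨x i, hx i⟩
    simp only [← hχ] at this
    exact this
  · rw [integral_map hJ.measurable.aemeasurable hc.measurable.aestronglyMeasurable]
    have : ∀ i, ∫ y, χ i y ∂(μ i) = ∫ y, φ i y ∂(ν i) := fun i => by
      rw [← hν i, (hemb i).integral_map]
      simp only [hχ]
    simp only [this]
    exact h2

end NoncompactDuality

/-! ### The Gibbs variational inequality -/

section Entropy

/-- The Gibbs variational inequality. -/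
theorem integral_le_klDiv_add_log {α : Type*} [MeasurableSpace α] {γ q : Measure α}
    [IsProbabilityMeasure γ] [IsProbabilityMeasure q] (hkl : InformationTheory.klDiv γ q ≠ ⊤)
    {f : α → ℝ} (hf : Integrable f γ) (hexp : Integrable (fun x => Real.exp (f x)) q) :
    ∫ x, f x ∂γ ≤ (InformationTheory.klDiv γ q).toReal + Real.log (∫ x, Real.exp (f x) ∂q) := by
  obtain ⟨hac, hint⟩ := InformationTheory.klDiv_ne_top_iff.1 hkl
  -- The claim is nonnegativity of the entropy of `γ` relative to the probability measure
  -- proportional to `exp f · q`.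
  have h1 := integral_llr_tilted_right hac hf hexp hint
  have hq : IsProbabilityMeasure (q.tilted f) := isProbabilityMeasure_tilted hexp
  have h2 := InformationTheory.integral_llr_add_sub_measure_univ_nonneg
    (hac.trans (absolutelyContinuous_tilted hexp)) (integrable_llr_tilted_right hac hf hint hexp)
  have h3 := InformationTheory.toReal_klDiv hac hint
  simp at h2 h3
  linarith

end Entropy

/-! ### From Laplace integrals to the entropic lower bound -/

section LowerBound

variable {m : ℕ} {X : Fin m → Type*} [∀ i, MetricSpace (X i)] [∀ i, MeasurableSpace (X i)]
  [∀ i, BorelSpace (X i)] [∀ i, SecondCountableTopology (X i)]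

/-- The entropic cost of a plan is bounded below by means of potentials and of the Laplace
integral of the gap `c - a - ⊕ᵢ φᵢ`. -/
lemma potentials_le_cost_add_entropy {μ : ∀ i, Measure (X i)} [∀ i, IsProbabilityMeasure (μ i)]
    {K : ∀ i, Set (X i)} (hK : ∀ i, IsCompact (K i)) (hμK : ∀ i, μ i (K i)ᶜ = 0)
    {c : (∀ i, X i) → ℝ} (hc : Continuous c) {a : ℝ} {φ : ∀ i, X i → ℝ}
    (hφ : ∀ i, Measurable (φ i)) (hφi : ∀ i, Integrable (φ i) (μ i))
    (hle : ∀ x ∈ Set.univ.pi K, a + ∑ i, φ i (x i) ≤ c x) {ε : ℝ} (hε : 0 < ε) {Z : ℝ}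
    (hZ : ∫⁻ x in Set.univ.pi K, ENNReal.ofReal (Real.exp (-(c x - (a + ∑ i, φ i (x i))) / ε))
      ∂(Measure.pi μ) ≤ ENNReal.ofReal Z) (hZ0 : 0 < Z)
    {γ : Measure (∀ i, X i)} (hγ : γ ∈ Plans μ)
    (hkl : InformationTheory.klDiv γ (Measure.pi μ) ≠ ⊤) :
    a + ∑ i, ∫ y, φ i y ∂(μ i) - ε * Real.log Z ≤
      ∫ x, c x ∂γ + ε * (InformationTheory.klDiv γ (Measure.pi μ)).toReal := by
  have := hγ.1
  set f : (∀ i, X i) → ℝ := fun x => -(c x - (a + ∑ i, φ i (x i))) / ε with hf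
  have hfm : Measurable f := by
    have := hc.measurable
    have : ∀ i, Measurable fun x : ∀ i, X i => φ i (x i) := fun i =>
      (hφ i).comp (measurable_pi_apply i)
    fun_prop
  obtain ⟨hs1, hs2⟩ := integral_sum_of_mem_Plans hγ a hφ hφi
  have hci : Integrable c γ := by
    have h1 : IntegrableOn c (Set.univ.pi K) γ :=
      hc.continuousOn.integrableOn_compact (isCompact_univ_pi hK)
    rwa [IntegrableOn, Measure.restrict_eq_self_of_ae_mem (ae_mem_of_mem_Plans hμK hγ)] at h1
  have hfi : Integrable f γ := ((hci.sub hs1).neg).div_const ε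
  have hae := ae_mem_of_mem_Plans hμK (pi_mem_Plans μ)
  have hfe : Integrable (fun x => Real.exp (f x)) (Measure.pi μ) := by
    refine Integrable.of_bound hfm.exp.aestronglyMeasurable 1 ?_
    filter_upwards [hae] with x hx
    rw [Real.norm_eq_abs, Real.abs_exp, Real.exp_le_one_iff]
    exact div_nonpos_of_nonpos_of_nonneg (by linarith [hle x hx]) hε.le
  have h1 := integral_le_klDiv_add_log hkl hfi hfe
  have h2 : ∫ x, f x ∂γ = -(∫ x, c x ∂γ - (a + ∑ i, ∫ y, φ i y ∂(μ i))) / ε := by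
    rw [← hs2, ← integral_sub hci hs1, ← integral_neg, ← integral_div]
  have h3 : Real.log (∫ x, Real.exp (f x) ∂(Measure.pi μ)) ≤ Real.log Z := by
    refine Real.log_le_log (integral_exp_pos hfe) ?_
    rw [integral_eq_lintegral_of_nonneg_ae (ae_of_all _ fun x => (Real.exp_pos _).le)
      hfm.exp.aestronglyMeasurable]
    refine ENNReal.toReal_le_of_le_ofReal hZ0.le ?_
    rwa [Measure.restrict_eq_self_of_ae_mem hae] at hZ
  rw [h2, div_le_iff₀ hε] at h1
  nlinarith

/-- A bound of order `εˢ` on the Laplace integrals of the gaps gives the lower bound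
`MOT₀ + s ε log (1 / ε) - O(ε)` for the entropic cost. -/
theorem MOT_add_le_entropicMOT {μ : ∀ i, Measure (X i)} [∀ i, IsProbabilityMeasure (μ i)]
    {K : ∀ i, Set (X i)} (hK : ∀ i, IsCompact (K i)) (hμK : ∀ i, μ i (K i)ᶜ = 0)
    {c : (∀ i, X i) → ℝ} (hc : Continuous c) {s B : ℝ} (hB : 0 < B)
    (hgap : ∀ (a : ℝ) (φ : ∀ i, X i → ℝ), (∀ i, Measurable (φ i)) →
      (∀ x ∈ Set.univ.pi K, a + ∑ i, φ i (x i) ≤ c x) → ∀ ε : ℝ, 0 < ε →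
      ∫⁻ x in Set.univ.pi K, ENNReal.ofReal (Real.exp (-(c x - (a + ∑ i, φ i (x i))) / ε))
        ∂(Measure.pi μ) ≤ ENNReal.ofReal (B * ε ^ s)) :
    ∃ C : ℝ, 0 ≤ C ∧ ∀ ε : ℝ, 0 < ε →
      MOT μ c + ((s * ε * Real.log (1 / ε) - C * ε : ℝ) : EReal) ≤ entropicMOT ε μ c := by
  -- The `1` pays for a duality gap equal to the regularisation parameter `ε`; `log B` comes from
  -- the Laplace bound.
  refine ⟨max 0 (1 + Real.log B), le_max_left _ _, fun ε hε => ?_⟩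
  obtain ⟨γ₀, hγ₀, a, φ, hφ, hφi, hle, hγ₀c⟩ := exists_plan_potentials μ hK hμK hc hε
  have hle' : ∀ x ∈ Set.univ.pi K, a + ∑ i, φ i (x i) ≤ c x := fun x hx =>
    hle x fun i => hx i trivial
  refine le_iInf₂ fun γ hγ => ?_
  by_cases hkl : InformationTheory.klDiv γ (Measure.pi μ) = ⊤
  · rw [hkl, ENNReal.mul_top (by simpa using hε), EReal.coe_ennreal_top, EReal.coe_add_top]
    exact le_top
  have h1 := potentials_le_cost_add_entropy hK hμK hc hφ hφi hle' hε (hgap a φ hφ hle' ε hε)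
    (by positivity) hγ hkl
  have h2 : ((ENNReal.ofReal ε * InformationTheory.klDiv γ (Measure.pi μ) : ENNReal) : EReal) =
      ((ε * (InformationTheory.klDiv γ (Measure.pi μ)).toReal : ℝ) : EReal) := by
    conv_lhs => rw [← ENNReal.ofReal_toReal hkl, ← ENNReal.ofReal_mul hε.le]
    rw [EReal.coe_ennreal_ofReal, max_eq_left (by positivity)]
  have h3 : MOT μ c ≤ ((∫ x, c x ∂γ₀ : ℝ) : EReal) := iInf₂_le _ hγ₀
  rw [h2, ← EReal.coe_add]
  refine (add_le_add_left h3 _).trans ?_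
  rw [← EReal.coe_add, EReal.coe_le_coe_iff]
  rw [Real.log_mul hB.ne' (by positivity), Real.log_rpow hε] at h1
  have h4 : Real.log (1 / ε) = -Real.log ε := by rw [one_div, Real.log_inv]
  have h5 : (1 + Real.log B) * ε ≤ max 0 (1 + Real.log B) * ε :=
    mul_le_mul_of_nonneg_right (le_max_right _ _) hε.le
  rw [h4]
  linarith

end LowerBound

/-! ### Positive eigenvalues and positive definite subspaces -/

section Inertia

open Matrix

variable {ι : Type*} [Fintype ι] [DecidableEq ι] {A : Matrix ι ι ℝ}

lemma posEigenvalues_eq_card (hA : A.IsHermitian) :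
    posEigenvalues A = (Finset.univ.filter fun i => 0 < hA.eigenvalues i).card := by
  rw [posEigenvalues, hA.roots_charpoly_eq_eigenvalues, Multiset.filter_map, Multiset.card_map]
  rfl

/-- A real symmetric matrix is diagonal in an orthonormal basis. -/
lemma Matrix.IsHermitian.exists_orthogonal (hA : A.IsHermitian) :
    ∃ P : Matrix ι ι ℝ, P * Pᵀ = 1 ∧ ∀ a : ι → ℝ,
      (P *ᵥ a) ⬝ᵥ (A *ᵥ (P *ᵥ a)) = ∑ i, hA.eigenvalues i * a i ^ 2 := by
  set U := hA.eigenvectorUnitary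
  have hU : (U : Matrix ι ι ℝ)ᵀ * (U : Matrix ι ι ℝ) = 1 := Unitary.coe_star_mul_self U
  refine ⟨U, Unitary.coe_mul_star_self U, fun a => ?_⟩
  have h1 : A * (U : Matrix ι ι ℝ) = (U : Matrix ι ι ℝ) * diagonal hA.eigenvalues := by
    have h := hA.spectral_theorem
    rw [Unitary.conjStarAlgAut_apply] at h
    conv_lhs => rw [h]
    rw [mul_assoc]
    change _ * ((U : Matrix ι ι ℝ)ᵀ * (U : Matrix ι ι ℝ)) = _
    rw [hU, mul_one]
    rfl
  rw [mulVec_mulVec, h1, ← mulVec_mulVec, dotProduct_mulVec, ← mulVec_transpose, mulVec_mulVec, hU,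
    one_mulVec]
  simp only [dotProduct, mulVec_diagonal]
  exact Finset.sum_congr rfl fun i _ => by ring

/-- A symmetric form with `k` positive eigenvalues is positive definite on a `k`-dimensional
subspace. -/
lemma exists_posDef_of_le_posEigenvalues (hA : A.IsHermitian) {k : ℕ}
    (hk : k ≤ posEigenvalues A) : ∃ (T : Euc k →ₗ[ℝ] (ι → ℝ)) (lam : ℝ), 0 < lam ∧
      ∀ u, lam * ‖u‖ ^ 2 ≤ T u ⬝ᵥ (A *ᵥ T u) := by
  obtain ⟨P, -, hP⟩ := hA.exists_orthogonal
  rw [posEigenvalues_eq_card hA, ← Fintype.card_coe, ← Fintype.card_fin k] at hk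
  obtain ⟨e⟩ := Function.Embedding.nonempty_of_card_le hk
  have he : ∀ j, 0 < hA.eigenvalues (e j) := fun j => (Finset.mem_filter.1 (e j).2).2
  have heinj : Function.Injective fun j => (e j : ι) := Subtype.val_injective.comp e.injective
  obtain ⟨lam, hlam, hmin⟩ : ∃ lam > 0, ∀ j, lam ≤ hA.eigenvalues (e j) := by
    rcases isEmpty_or_nonempty (Fin k) with h | h
    · exact ⟨1, one_pos, fun j => h.elim j⟩
    · obtain ⟨j, hj⟩ := Finite.exists_min fun j => hA.eigenvalues (e j)
      exact ⟨_, he j, hj⟩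
  let F : Euc k →ₗ[ℝ] (ι → ℝ) :=
    { toFun := fun u => ∑ j, u j • Pi.single (e j : ι) (1 : ℝ)
      map_add' := fun u v => by simp [add_smul, Finset.sum_add_distrib]
      map_smul' := fun r u => by simp [Finset.smul_sum, mul_smul] }
  have hF : ∀ u j, F u (e j) = u j := fun u j => by
    change (∑ l, u l • Pi.single (e l : ι) (1 : ℝ)) (e j : ι) = u j
    rw [Finset.sum_apply, Finset.sum_eq_single j]
    · simp
    · intro l _ hl
      simp [Pi.single_eq_of_ne (heinj.ne hl.symm)]
    · simp
  have hF0 : ∀ u i, (∀ j, (e j : ι) ≠ i) → F u i = 0 := fun u i hi => by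
    change (∑ l, u l • Pi.single (e l : ι) (1 : ℝ)) i = 0
    rw [Finset.sum_apply]
    refine Finset.sum_eq_zero fun l _ => ?_
    simp [Pi.single_eq_of_ne (hi l).symm]
  refine ⟨P.mulVecLin ∘ₗ F, lam, hlam, fun u => ?_⟩
  simp only [LinearMap.comp_apply, mulVecLin_apply, hP]
  have h1 : ∑ i, hA.eigenvalues i * F u i ^ 2 = ∑ j, hA.eigenvalues (e j) * u j ^ 2 := by
    simp only [← hF u]
    rw [← Finset.sum_image (s := Finset.univ) (g := fun j => (e j : ι))
      (f := fun i => hA.eigenvalues i * F u i ^ 2) heinj.injOn]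
    refine (Finset.sum_subset (Finset.subset_univ _) fun i _ hi => ?_).symm
    rw [hF0 u i fun j hj => hi (Finset.mem_image.2 ⟨j, Finset.mem_univ _, hj⟩)]
    ring
  rw [h1, EuclideanSpace.real_norm_sq_eq, Finset.mul_sum]
  exact Finset.sum_le_sum fun j _ => mul_le_mul_of_nonneg_right (hmin j) (sq_nonneg _)

/-- A symmetric form which is positive definite on a `k`-dimensional subspace has at least `k`
positive eigenvalues. -/
lemma finrank_le_posEigenvalues (hA : A.IsHermitian) {V : Type*} [AddCommGroup V] [Module ℝ V]
    [Module.Finite ℝ V] (T : V →ₗ[ℝ] (ι → ℝ)) (hT : ∀ u ≠ 0, 0 < T u ⬝ᵥ (A *ᵥ T u)) :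
    Module.finrank ℝ V ≤ posEigenvalues A := by
  obtain ⟨P, hP1, hP⟩ := hA.exists_orthogonal
  by_contra! hlt
  rw [posEigenvalues_eq_card hA, ← Fintype.card_coe, ← Module.finrank_fintype_fun_eq_card ℝ] at hlt
  set S := Finset.univ.filter fun i => 0 < hA.eigenvalues i with hS
  -- By dimension, some nonzero `u` has `T u` orthogonal to every eigenvector with positive
  -- eigenvalue, so the form is nonpositive there.
  obtain ⟨u, hu, hu0⟩ := Submodule.exists_mem_ne_zero_of_ne_bot (LinearMap.ker_ne_bot_of_finrank_lt
    (f := (LinearMap.funLeft ℝ ℝ (Subtype.val : S → ι)) ∘ₗ Pᵀ.mulVecLin ∘ₗ T) hlt)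
  have h1 := hT u hu0
  rw [← one_mulVec (T u), ← hP1, ← mulVec_mulVec, hP] at h1
  refine absurd h1 (not_lt.2 (Finset.sum_nonpos fun i _ => ?_))
  by_cases hi : i ∈ S
  · have : (Pᵀ *ᵥ T u) i = 0 := congrFun (LinearMap.mem_ker.1 hu) ⟨i, hi⟩
    rw [this]
    simp
  · refine mul_nonpos_of_nonpos_of_nonneg (not_lt.1 fun h => hi ?_) (sq_nonneg _)
    exact Finset.mem_filter.2 ⟨Finset.mem_univ _, h⟩

end Inertia

/-! ### Second differences of functions of class C² -/

section SecondDifference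

/-- Second differences of a `C²` function are approximated by its second derivative. -/
lemma ContDiffAt.exists_second_difference_le {E : Type*} [NormedAddCommGroup E] [NormedSpace ℝ E]
    {f : E → ℝ} {y₀ : E} (hf : ContDiffAt ℝ 2 f y₀) {η : ℝ} (hη : 0 < η) :
    ∃ ρ > 0, ∀ y h k, y ∈ Metric.ball y₀ ρ → y + h ∈ Metric.ball y₀ ρ →
      y + k ∈ Metric.ball y₀ ρ → y + h + k ∈ Metric.ball y₀ ρ →
      |f (y + h + k) - f (y + k) - f (y + h) + f y - fderiv ℝ (fderiv ℝ f) y₀ h k| ≤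
        η * ‖h‖ * ‖k‖ := by
  have h1 : ContDiffAt ℝ 1 (fderiv ℝ f) y₀ := hf.fderiv_right (by norm_num)
  -- Strict differentiability of the derivative controls its increments uniformly over pairs of
  -- points near `y₀`.
  have h2 := (h1.hasStrictFDerivAt one_ne_zero).isLittleO.def hη
  have h3 : ∀ᶠ y in nhds y₀, DifferentiableAt ℝ f y :=
    (hf.eventually (by simp)).mono fun y hy => hy.differentiableAt (by simp)
  rw [nhds_prod_eq] at h2
  obtain ⟨r, hr, h2⟩ := (Metric.nhds_basis_ball.prod_self.eventually_iff).1 h2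
  obtain ⟨r', hr', h3⟩ := Metric.eventually_nhds_iff_ball.1 h3
  refine ⟨min r r', lt_min hr hr', fun y h k hy hh hk hhk => ?_⟩
  set D := fderiv ℝ (fderiv ℝ f) y₀
  set s : Set E := {z | z ∈ Metric.ball y₀ (min r r') ∧ z + h ∈ Metric.ball y₀ (min r r')} with hs
  have hconv : Convex ℝ s :=
    (convex_ball _ _).inter ((convex_ball y₀ (min r r')).translate_preimage_left h)
  -- The mean value inequality is applied in direction `k` to the first difference in direction `h`,
  -- minus its linear model.
  have hd : ∀ z ∈ s, HasFDerivWithinAt (fun z => f (z + h) - f z - D h z)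
      (fderiv ℝ f (z + h) - fderiv ℝ f z - D h) s z := fun z hz => by
    have ha := h3 _ (Metric.ball_subset_ball (min_le_right _ _) hz.1)
    have hb := h3 _ (Metric.ball_subset_ball (min_le_right _ _) hz.2)
    exact ((((hasFDerivAt_comp_add_right h).2 hb.hasFDerivAt).sub ha.hasFDerivAt).sub
      (D h).hasFDerivAt).hasFDerivWithinAt
  have hbd : ∀ z ∈ s, ‖fderiv ℝ f (z + h) - fderiv ℝ f z - D h‖ ≤ η * ‖h‖ := fun z hz => by
    have := h2 (Set.mk_mem_prod (Metric.ball_subset_ball (min_le_left _ _) hz.2)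
      (Metric.ball_subset_ball (min_le_left _ _) hz.1))
    simpa using this
  have := hconv.norm_image_sub_le_of_norm_hasFDerivWithin_le hd hbd (x := y) (y := y + k)
    ⟨hy, hh⟩ ⟨hk, by rwa [add_right_comm] at hhk⟩
  rw [Real.norm_eq_abs, add_sub_cancel_left, map_add, add_right_comm] at this
  convert this using 2
  ring

end SecondDifference

/-! ### The forms `g_p` and coercivity of the gap -/

section PassForm

open Matrix

variable {m N : ℕ} {X : Fin m → Set (Euc N)} {d : Fin m → ℕ} {c : (∀ i, X i) → ℝ}
  {ψ : ∀ i, OpenPartialHomeomorph (X i) (Euc (d i))} {x : ∀ i, X i}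

lemma mixedHessian_apply (i j : Fin m) (a : Fin (d i)) (b : Fin (d j)) :
    mixedHessian c ψ x i j a b =
      fderiv ℝ (fderiv ℝ (inCharts c ψ)) (fun k => ψ k (x k))
        (Pi.single i (EuclideanSpace.single a 1)) (Pi.single j (EuclideanSpace.single b 1)) := by
  rw [mixedHessian, of_apply, iteratedFDeriv_two_apply]
  rfl

lemma IsC2Cost.contDiffAt (hc : IsC2Cost d c) (hψ : ∀ i, IsC2Chart (X i) (ψ i))
    (hx : ∀ i, x i ∈ (ψ i).source) : ContDiffAt ℝ 2 (inCharts c ψ) fun k => ψ k (x k) :=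
  (hc ψ hψ).contDiffAt ((isOpen_set_pi Set.finite_univ fun i _ => (ψ i).open_target).mem_nhds
    fun i _ => (ψ i).map_source (hx i))

lemma mixedHessian_comm (h : ContDiffAt ℝ 2 (inCharts c ψ) fun k => ψ k (x k))
    (i j : Fin m) (a : Fin (d i)) (b : Fin (d j)) :
    mixedHessian c ψ x j i b a = mixedHessian c ψ x i j a b := by
  rw [mixedHessian_apply, mixedHessian_apply]
  exact h.isSymmSndFDerivAt (by simp) _ _

lemma transpose_blockHessian (h : ContDiffAt ℝ 2 (inCharts c ψ) fun k => ψ k (x k))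
    (p q : Finset (Fin m)) : (blockHessian c ψ x p q)ᵀ = blockHessian c ψ x q p := by
  ext α β
  simp only [transpose_apply, blockHessian, of_apply, mixedHessian_comm h α.1 β.1 α.2 β.2,
    and_comm]

lemma isHermitian_of_mem_passHull (h : ContDiffAt ℝ 2 (inCharts c ψ) fun k => ψ k (x k))
    {g : Matrix (Σ i, Fin (d i)) (Σ i, Fin (d i)) ℝ} (hg : g ∈ passHull c ψ x) :
    g.IsHermitian := by
  have hconv : Convex ℝ {g : Matrix (Σ i, Fin (d i)) (Σ i, Fin (d i)) ℝ | gᵀ = g} := by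
    intro a ha b hb s t _ _ _
    simp only [Set.mem_ofPred_eq] at ha hb ⊢
    rw [transpose_add, transpose_smul, transpose_smul, ha, hb]
  refine (convexHull_min ?_ hconv hg : gᵀ = g)
  rintro _ ⟨p, -, -, rfl⟩
  simp only [Set.mem_ofPred_eq, passForm, transpose_add, transpose_blockHessian h]
  exact add_comm _ _

lemma Finset.piecewise_zero_eq_sum (p : Finset (Fin m)) (h : ∀ i, Euc (d i)) :
    p.piecewise h 0 = ∑ α : Σ i, Fin (d i), (if α.1 ∈ p then h α.1 α.2 else 0) •
      (Pi.single α.1 (EuclideanSpace.single α.2 (1 : ℝ)) : ∀ i, Euc (d i)) := by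
  funext j
  ext b
  rw [Finset.sum_apply, WithLp.ofLp_sum, Finset.sum_apply, Finset.sum_eq_single ⟨j, b⟩]
  · by_cases hj : j ∈ p <;> simp [hj]
  · rintro ⟨i, a⟩ - hne
    by_cases hij : j = i
    · subst hij
      have : b ≠ a := fun h => hne (by rw [h])
      by_cases hj : j ∈ p <;> simp [hj, this]
    · simp [Pi.single_eq_of_ne hij]
  · simp

lemma dotProduct_blockHessian (p q : Finset (Fin m)) (h k : ∀ i, Euc (d i)) :
    (fun α : Σ i, Fin (d i) => h α.1 α.2) ⬝ᵥ
        (blockHessian c ψ x p q *ᵥ fun α : Σ i, Fin (d i) => k α.1 α.2) =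
      fderiv ℝ (fderiv ℝ (inCharts c ψ)) (fun k => ψ k (x k)) (p.piecewise h 0)
        (q.piecewise k 0) := by
  rw [Finset.piecewise_zero_eq_sum p, Finset.piecewise_zero_eq_sum q]
  simp only [map_sum, _root_.sum_apply, map_smul, _root_.smul_apply,
    smul_eq_mul, dotProduct, mulVec, blockHessian, of_apply, mixedHessian_apply, Finset.mul_sum]
  rw [Finset.sum_comm]
  refine Finset.sum_congr rfl fun β _ => Finset.sum_congr rfl fun α _ => ?_
  by_cases hα : α.1 ∈ p <;> by_cases hβ : β.1 ∈ q <;> simp [hα, hβ]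
  ring

/-- The two off-diagonal blocks contribute equally by symmetry of the second derivative, whence the
factor `2`. -/
lemma dotProduct_passForm (hc : ContDiffAt ℝ 2 (inCharts c ψ) fun k => ψ k (x k))
    (p : Finset (Fin m)) (h : ∀ i, Euc (d i)) :
    (fun α : Σ i, Fin (d i) => h α.1 α.2) ⬝ᵥ
        (passForm c ψ x p *ᵥ fun α : Σ i, Fin (d i) => h α.1 α.2) =
      2 * fderiv ℝ (fderiv ℝ (inCharts c ψ)) (fun k => ψ k (x k)) (p.piecewise h 0)
        (pᶜ.piecewise h 0) := by
  rw [passForm, add_mulVec, dotProduct_add, dotProduct_blockHessian, dotProduct_blockHessian,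
    hc.isSymmSndFDerivAt (by simp) (pᶜ.piecewise h 0)]
  ring

/-- Near a point where some form of `G_c` has `κ` positive eigenvalues, the gap between the cost
and any separable minorant is coercive in `κ` directions. -/
theorem exists_gap_coercive (hc : ContDiffAt ℝ 2 (inCharts c ψ) fun k => ψ k (x k))
    {g : Matrix (Σ i, Fin (d i)) (Σ i, Fin (d i)) ℝ} (hg : g ∈ passHull c ψ x) {κ : ℕ}
    (hκ : κ ≤ posEigenvalues g) :
    ∃ (T : Euc κ →ₗ[ℝ] (∀ i, Euc (d i))), Function.Injective T ∧ ∃ lam > 0, ∃ ρ > 0,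
      ∀ (S : ∀ i, Set (Euc (d i))), (∀ i, S i ⊆ Metric.ball (ψ i (x i)) ρ) →
      ∀ (a : ℝ) (φ : ∀ i, Euc (d i) → ℝ),
      (∀ y ∈ Set.univ.pi S, a + ∑ i, φ i (y i) ≤ inCharts c ψ y) →
      ∀ y ∈ Set.univ.pi S, ∀ u, y + T u ∈ Set.univ.pi S →
        lam * ‖u‖ ^ 2 ≤ (inCharts c ψ y - (a + ∑ i, φ i (y i))) +
          (inCharts c ψ (y + T u) - (a + ∑ i, φ i ((y + T u) i))) := by
  obtain ⟨T₀, lam, hlam, hT₀⟩ :=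
    exists_posDef_of_le_posEigenvalues (isHermitian_of_mem_passHull hc hg) hκ
  let T : Euc κ →ₗ[ℝ] (∀ i, Euc (d i)) :=
    { toFun := fun u i => WithLp.toLp 2 fun a => T₀ u ⟨i, a⟩
      map_add' := fun u v => by ext; simp
      map_smul' := fun r u => by ext; simp }
  have hT : ∀ u, (fun α : Σ i, Fin (d i) => T u α.1 α.2) = T₀ u := fun u => rfl
  have hinj : Function.Injective T := by
    rw [injective_iff_map_eq_zero]
    intro u hu
    have h1 := hT₀ u
    rw [← hT, hu] at h1
    simp [dotProduct] at h1
    have : ‖u‖ ^ 2 ≤ 0 := nonpos_of_mul_nonpos_right h1 hlam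
    simpa using le_antisymm this (sq_nonneg _)
  set M := ‖LinearMap.toContinuousLinearMap T‖
  have hM : ∀ u, ‖T u‖ ≤ M * ‖u‖ := fun u => (LinearMap.toContinuousLinearMap T).le_opNorm u
  have hM0 : 0 ≤ M := norm_nonneg _
  -- Half of the form gives `lam / 2`; this choice loses at most `lam / 4` to the second-difference
  -- error.
  set η := lam / (4 * (M ^ 2 + 1)) with hη
  have hη0 : 0 < η := by positivity
  obtain ⟨ρ, hρ, hsd⟩ := hc.exists_second_difference_le hη0
  refine ⟨T, hinj, lam / 4, by positivity, ρ, hρ, fun S hS a φ hle y hy u hyu => ?_⟩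
  have hball : ∀ z ∈ Set.univ.pi S, z ∈ Metric.ball (fun k => ψ k (x k)) ρ := fun z hz => by
    rw [ball_pi _ hρ]
    exact fun i _ => hS i (hz i trivial)
  set h := T u with hh
  set R := (inCharts c ψ y - (a + ∑ i, φ i (y i))) +
          (inCharts c ψ (y + h) - (a + ∑ i, φ i ((y + h) i))) with hR
  have hpass : ∀ p : Finset (Fin m), 1 / 2 * ((fun α : Σ i, Fin (d i) => h α.1 α.2) ⬝ᵥ
      (passForm c ψ x p *ᵥ fun α : Σ i, Fin (d i) => h α.1 α.2)) ≤ R + η * ‖h‖ ^ 2 := fun p => by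
    -- The swapped points are `y + k` and `y + l`; each coordinate of either comes from `y` or from
    -- `y + h`.
    set k := p.piecewise h 0 with hk
    set l := pᶜ.piecewise h 0 with hl
    have hkl : y + k + l = y + h := by
      rw [add_assoc]
      congr 1
      funext i
      by_cases hi : i ∈ p <;> simp [hk, hl, hi]
    have hcase : ∀ i, ((y + k) i = (y + h) i ∧ (y + l) i = y i) ∨
        ((y + k) i = y i ∧ (y + l) i = (y + h) i) := fun i => by
      by_cases hi : i ∈ p
      · left; simp [hk, hl, hi]
      · right; simp [hk, hl, hi]
    -- The product shape of the domain keeps the swapped points inside it, so the minorant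
    -- inequality holds there.
    have hyk : y + k ∈ Set.univ.pi S := fun i _ => by
      rcases hcase i with h | h <;> rw [h.1]
      exacts [hyu i trivial, hy i trivial]
    have hyl : y + l ∈ Set.univ.pi S := fun i _ => by
      rcases hcase i with h | h <;> rw [h.2]
      exacts [hy i trivial, hyu i trivial]
    have hsum : ∑ i, φ i ((y + k) i) + ∑ i, φ i ((y + l) i) =
        ∑ i, φ i (y i) + ∑ i, φ i ((y + h) i) := by
      rw [← Finset.sum_add_distrib, ← Finset.sum_add_distrib]
      refine Finset.sum_congr rfl fun i _ => ?_
      rcases hcase i with h | h <;> rw [h.1, h.2]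
      rw [add_comm]
    have hnk : ‖k‖ ≤ ‖h‖ := (pi_norm_le_iff_of_nonneg (norm_nonneg _)).2 fun i => by
      by_cases hi : i ∈ p <;> simp [hk, hi, norm_le_pi_norm]
    have hnl : ‖l‖ ≤ ‖h‖ := (pi_norm_le_iff_of_nonneg (norm_nonneg _)).2 fun i => by
      by_cases hi : i ∈ p <;> simp [hl, hi, norm_le_pi_norm]
    have h1 := (abs_le.1 (hsd y k l (hball _ hy) (hball _ hyk) (hball _ hyl)
      (hball _ (hkl ▸ hyu)))).1
    have h2 : η * ‖k‖ * ‖l‖ ≤ η * ‖h‖ ^ 2 := by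
      rw [mul_assoc, pow_two]
      gcongr
    rw [hkl] at h1
    rw [dotProduct_passForm hc]
    have h3 := hle _ hyk
    have h4 := hle _ hyl
    rw [hR]
    linarith
  -- For fixed `h` the inequality is affine in the form, hence passes to the convex hull.
  have hhull : 1 / 2 * ((fun α : Σ i, Fin (d i) => h α.1 α.2) ⬝ᵥ
      (g *ᵥ fun α : Σ i, Fin (d i) => h α.1 α.2)) ≤ R + η * ‖h‖ ^ 2 := by
    refine convexHull_min (𝕜 := ℝ) (t := {g : Matrix (Σ i, Fin (d i)) (Σ i, Fin (d i)) ℝ |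
      1 / 2 * ((fun α : Σ i, Fin (d i) => h α.1 α.2) ⬝ᵥ
      (g *ᵥ fun α : Σ i, Fin (d i) => h α.1 α.2)) ≤ R + η * ‖h‖ ^ 2}) ?_
      (convex_halfSpace_le (f := fun g : Matrix (Σ i, Fin (d i)) (Σ i, Fin (d i)) ℝ =>
        1 / 2 * ((fun α : Σ i, Fin (d i) => h α.1 α.2) ⬝ᵥ
          (g *ᵥ fun α : Σ i, Fin (d i) => h α.1 α.2))) ⟨fun A B => ?_, fun r A => ?_⟩ _) hg
    · rintro _ ⟨p, -, -, rfl⟩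
      exact hpass p
    · rw [add_mulVec, dotProduct_add, mul_add]
    · rw [smul_mulVec, dotProduct_smul, smul_eq_mul, smul_eq_mul]
      ring
  rw [hT u] at hhull
  have h1 := hT₀ u
  have h2 : ‖h‖ ^ 2 ≤ M ^ 2 * ‖u‖ ^ 2 := by
    rw [← mul_pow]
    exact pow_le_pow_left₀ (norm_nonneg _) (hM u) 2
  have h3 : η * ‖h‖ ^ 2 ≤ lam / 4 * ‖u‖ ^ 2 := by
    calc η * ‖h‖ ^ 2 ≤ η * ((M ^ 2 + 1) * ‖u‖ ^ 2) := by
          gcongr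
          nlinarith [sq_nonneg ‖u‖]
      _ = lam / 4 * ‖u‖ ^ 2 := by
          rw [hη]
          field_simp
  linarith

end PassForm

/-! ### Rank of the mixed Hessian and signature -/

section TwoMarginals

open Matrix

variable {N : ℕ} {X : Fin 2 → Set (Euc N)} {d : Fin 2 → ℕ} {c : (∀ i, X i) → ℝ}
  {ψ : ∀ i, OpenPartialHomeomorph (X i) (Euc (d i))} {x : ∀ i, X i}

/-- At `(Bw, w)` each off-diagonal block contributes `|Bw|²`, positive for nonzero `w` in a
complement of `ker B`; that complement has dimension `rank B`. -/
lemma rank_mixedHessian_le_posEigenvalues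
    (hc : ContDiffAt ℝ 2 (inCharts c ψ) fun k => ψ k (x k)) :
    (mixedHessian c ψ x 0 1).rank ≤ posEigenvalues (passForm c ψ x {0}) := by
  have hmem : passForm c ψ x {0} ∈ passHull c ψ x :=
    subset_convexHull ℝ _ ⟨{0}, by simp, ⟨1, by simp⟩, rfl⟩
  set B := mixedHessian c ψ x 0 1 with hB
  obtain ⟨V, hV⟩ := Submodule.exists_isCompl (LinearMap.ker B.mulVecLin)
  have hrank : B.rank = Module.finrank ℝ V := by
    have h1 := LinearMap.finrank_range_add_finrank_ker B.mulVecLin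
    have h2 := Submodule.finrank_add_eq_of_isCompl hV
    rw [Matrix.rank]
    omega
  rw [hrank]
  let T : V →ₗ[ℝ] ((Σ i, Fin (d i)) → ℝ) :=
    { toFun := fun w α => Fin.cases (motive := fun i => Fin (d i) → ℝ) (B *ᵥ (w : Fin (d 1) → ℝ))
        (fun j => Fin.cases (motive := fun j => Fin (d j.succ) → ℝ) (w : Fin (d 1) → ℝ)
          (fun k => k.elim0) j) α.1 α.2
      map_add' := fun v w => by
        funext ⟨i, a⟩
        fin_cases i
        · exact congrFun (mulVec_add B v w) a
        · rfl
      map_smul' := fun r w => by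
        funext ⟨i, a⟩
        fin_cases i
        · exact congrFun (mulVec_smul B r w) a
        · rfl }
  have hT0 : ∀ w a, T w ⟨0, a⟩ = (B *ᵥ (w : Fin (d 1) → ℝ)) a := fun w a => rfl
  have hT1 : ∀ w b, T w ⟨1, b⟩ = (w : Fin (d 1) → ℝ) b := fun w b => rfl
  refine finrank_le_posEigenvalues (isHermitian_of_mem_passHull hc hmem) T fun w hw => ?_
  have h1 : T w ⬝ᵥ (blockHessian c ψ x {0} {0}ᶜ *ᵥ T w) = (B *ᵥ w) ⬝ᵥ (B *ᵥ w) := by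
    simp only [dotProduct, mulVec, Fintype.sum_sigma, Fin.sum_univ_two, blockHessian, of_apply]
    simp [hT0, hT1, mulVec, dotProduct, hB]
  have h2 : T w ⬝ᵥ (blockHessian c ψ x {0}ᶜ {0} *ᵥ T w) = (B *ᵥ w) ⬝ᵥ (B *ᵥ w) := by
    rw [← transpose_blockHessian hc, dotProduct_mulVec, vecMul_transpose, dotProduct_comm, h1]
  rw [passForm, add_mulVec, dotProduct_add, h1, h2]
  have h3 : B *ᵥ (w : Fin (d 1) → ℝ) ≠ 0 := fun h => hw <| by
    have := Submodule.disjoint_def.1 hV.disjoint w (LinearMap.mem_ker.2 h) w.2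
    exact Subtype.ext this
  have h4 : 0 < (B *ᵥ (w : Fin (d 1) → ℝ)) ⬝ᵥ (B *ᵥ (w : Fin (d 1) → ℝ)) :=
    (Finset.sum_nonneg fun i _ => mul_self_nonneg _).lt_of_ne' fun h => h3 (dotProduct_self_eq_zero.1 h)
  linarith

end TwoMarginals

/-! ### Gaussian bounds on slices -/

section Slicing

/-- A gap which is coercive on a subset of `ℝᵏ` has Laplace integral `O(ε^{k/2})`. -/
lemma lintegral_exp_neg_le_of_coercive {k : ℕ} {S : Set (Euc k)} {e : Euc k → ℝ} {lam : ℝ}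
    (hlam : 0 < lam) (he : ∀ u ∈ S, 0 ≤ e u)
    (h : ∀ u ∈ S, ∀ v ∈ S, lam * ‖v - u‖ ^ 2 ≤ e u + e v) {ε : ℝ} (hε : 0 < ε) :
    ∫⁻ u, S.indicator (fun u => ENNReal.ofReal (Real.exp (-e u / ε))) u ≤
      ENNReal.ofReal (Real.exp (1 / 2) * (2 * Real.pi / lam) ^ ((k : ℝ) / 2) *
        ε ^ ((k : ℝ) / 2)) := by
  rcases S.eq_empty_or_nonempty with rfl | hS
  · simp
  have hbdd : BddBelow (e '' S) := ⟨0, by rintro _ ⟨u, hu, rfl⟩; exact he u hu⟩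
  -- A minimum need not exist. An error `ε` in the infimum gives `lam * ‖u - u₀‖² ≤ 2 e(u) + ε`,
  -- costing only the factor `exp (1 / 2)`.
  obtain ⟨_, ⟨u₀, hu₀, rfl⟩, hlt⟩ := Real.lt_sInf_add_pos (hS.image e) hε
  have hmin : ∀ u ∈ S, e u₀ ≤ e u + ε := fun u hu =>
    hlt.le.trans (by linarith [csInf_le hbdd ⟨u, hu, rfl⟩])
  set b := lam / (2 * ε) with hb
  have hb0 : 0 < b := by positivity
  have hpt : ∀ u, S.indicator (fun u => ENNReal.ofReal (Real.exp (-e u / ε))) u ≤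
      ENNReal.ofReal (Real.exp (1 / 2) * Real.exp (-b * ‖u - u₀‖ ^ 2)) := fun u => by
    by_cases hu : u ∈ S
    · rw [Set.indicator_of_mem hu, ← Real.exp_add]
      refine ENNReal.ofReal_le_ofReal (Real.exp_le_exp.2 ?_)
      have h1 := h u₀ hu₀ u hu
      have h2 := hmin u hu
      rw [div_le_iff₀ hε]
      have h3 : b * ε = lam / 2 := by
        rw [hb]
        field_simp
      have h4 : (1 / 2 + -b * ‖u - u₀‖ ^ 2) * ε = ε / 2 - b * ε * ‖u - u₀‖ ^ 2 := by ring
      rw [h4, h3]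
      linarith
    · rw [Set.indicator_of_notMem hu]
      exact zero_le
  refine (lintegral_mono hpt).trans_eq ?_
  rw [lintegral_sub_right_eq_self (fun u : Euc k =>
    ENNReal.ofReal (Real.exp (1 / 2) * Real.exp (-b * ‖u‖ ^ 2)))]
  have hval := GaussianFourier.integral_rexp_neg_mul_sq_norm (V := Euc k) hb0
  rw [← ofReal_integral_eq_lintegral_ofReal, integral_const_mul, hval, mul_assoc,
    ← Real.mul_rpow (by positivity) hε.le]
  · rw [finrank_euclideanSpace_fin, hb]
    congr 3
    field_simp
  · refine Integrable.const_mul (Integrable.of_integral_ne_zero ?_) _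
    rw [hval]
    positivity
  · exact ae_of_all _ fun u => by positivity

/-- A gap which is coercive along the `k`-dimensional slices parallel to the range of `T` has
Laplace integral `O(ε^{k/2})` on bounded sets. -/
theorem exists_lintegral_exp_neg_le {E : Type*} [NormedAddCommGroup E] [NormedSpace ℝ E]
    [FiniteDimensional ℝ E] [MeasurableSpace E] [BorelSpace E] (μ : Measure E)
    [μ.IsAddHaarMeasure] {k : ℕ} {T : Euc k →ₗ[ℝ] E} (hT : Function.Injective T) {lam : ℝ}
    (hlam : 0 < lam) {B : Set E} (hB : Bornology.IsBounded B) :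
    ∃ C : ℝ, ∀ S ⊆ B, ∀ e : E → ℝ, (∀ y ∈ S, 0 ≤ e y) →
      (∀ y ∈ S, ∀ u, y + T u ∈ S → lam * ‖u‖ ^ 2 ≤ e y + e (y + T u)) → ∀ ε : ℝ, 0 < ε →
      ∫⁻ y, S.indicator (fun y => ENNReal.ofReal (Real.exp (-e y / ε))) y ∂μ ≤
        ENNReal.ofReal (C * ε ^ ((k : ℝ) / 2)) := by
  obtain ⟨W, hW⟩ := Submodule.exists_isCompl (LinearMap.range T)
  let L₀ : (W × Euc k) ≃ₗ[ℝ] E :=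
    ((LinearEquiv.refl ℝ W).prodCongr (LinearEquiv.ofInjective T hT)).trans
      (W.prodEquivOfIsCompl _ hW.symm)
  let L : (W × Euc k) ≃L[ℝ] E := L₀.toContinuousLinearEquiv
  have hL : ∀ w u, L (w, u) = w + T u := fun w u => rfl
  let ν : Measure (W × Euc k) := (Measure.addHaar : Measure W).prod volume
  have : (ν.map L).IsAddHaarMeasure := L.isAddHaarMeasure_map ν
  have hμ := Measure.isAddLeftInvariant_eq_smul μ (ν.map L)
  set c := Measure.addHaarScalarFactor μ (ν.map L)
  -- Only base points in a fixed ball of the transverse space `W` have slices meeting `B`.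
  obtain ⟨R, hR⟩ := ((L.symm.lipschitz.isBounded_image hB).image_fst).subset_closedBall (0 : W)
  set M := Real.exp (1 / 2) * (2 * Real.pi / lam) ^ ((k : ℝ) / 2) with hM
  have hM0 : 0 ≤ M := by positivity
  set V := (Measure.addHaar : Measure W) (Metric.closedBall 0 R) with hV
  have hVtop : V ≠ ⊤ := measure_closedBall_lt_top.ne
  refine ⟨c * V.toReal * M, fun S hS e he h ε hε => ?_⟩
  set F : E → ENNReal := S.indicator fun y => ENNReal.ofReal (Real.exp (-e y / ε)) with hF
  have hslice : ∀ w : W, ∫⁻ u, F (L (w, u)) ≤ (Metric.closedBall (0 : W) R).indicator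
      (fun _ => ENNReal.ofReal (M * ε ^ ((k : ℝ) / 2))) w := fun w => by
    by_cases hw : w ∈ Metric.closedBall (0 : W) R
    · rw [Set.indicator_of_mem hw]
      have hFw : ∀ u, F (L (w, u)) = {u | L (w, u) ∈ S}.indicator
          (fun u => ENNReal.ofReal (Real.exp (-e (L (w, u)) / ε))) u := fun u => rfl
      simp only [hFw]
      refine lintegral_exp_neg_le_of_coercive hlam (fun u hu => he _ hu) (fun u hu v hv => ?_) hε
      have huv : L (w, v) = L (w, u) + T (v - u) := by
        rw [hL, hL, map_sub]
        abel
      rw [huv]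
      exact h _ hu _ (huv ▸ hv)
    · have hFw : ∀ u, F (L (w, u)) = 0 := fun u => Set.indicator_of_notMem (fun hmem => hw <|
        hR ⟨(w, u), ⟨_, hS hmem, L.symm_apply_apply _⟩, rfl⟩) _
      simp [hFw]
  calc ∫⁻ y, F y ∂μ = c * ∫⁻ y, F y ∂(ν.map L) := by
        conv_lhs => rw [hμ]
        rw [lintegral_smul_measure]
        rfl
    _ = c * ∫⁻ z, F (L z) ∂ν := by
        congr 1
        exact lintegral_map_equiv F L.toHomeomorph.toMeasurableEquiv
    -- This half of Tonelli needs no measurability of `F`; `S` and `e` are arbitrary.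
    _ ≤ c * ∫⁻ w, (∫⁻ u, F (L (w, u))) ∂(Measure.addHaar : Measure W) := by
        gcongr
        exact lintegral_prod_le _
    _ ≤ c * ∫⁻ w, (Metric.closedBall (0 : W) R).indicator
          (fun _ => ENNReal.ofReal (M * ε ^ ((k : ℝ) / 2))) w ∂(Measure.addHaar : Measure W) := by
        gcongr with w
        exact hslice w
    _ = ENNReal.ofReal (c * V.toReal * M * ε ^ ((k : ℝ) / 2)) := by
        rw [lintegral_indicator_const Metric.isClosed_closedBall.measurableSet, ← hV, mul_assoc _ M,
          ENNReal.ofReal_mul (p := c * V.toReal) (by positivity),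
          ENNReal.ofReal_mul (p := (c : ℝ)) c.2, ENNReal.ofReal_toReal hVtop,
          ENNReal.ofReal_coe_nnreal, mul_assoc (c : ENNReal), mul_comm V]

end Slicing

/-! ### Domination of product measures -/

section ProductMeasures

variable {ι : Type*} [Fintype ι] {Y : ι → Type*} [∀ i, MeasurableSpace (Y i)]

/-- The product outer measure is the largest one bounded on boxes by the product of the factors, so
comparison on boxes suffices. -/
lemma MeasureTheory.Measure.pi_le_smul_pi {μ ν : ∀ i, Measure (Y i)} [∀ i, IsFiniteMeasure (μ i)]
    [∀ i, IsFiniteMeasure (ν i)] {C : ι → NNReal} (h : ∀ i, μ i ≤ C i • ν i) :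
    Measure.pi μ ≤ (∏ i, C i) • Measure.pi ν := by
  have h1 : Measure.pi (fun i => C i • ν i) = (∏ i, C i) • Measure.pi ν :=
    Measure.pi_eq fun s _ => by
      rw [Measure.smul_apply, Measure.pi_pi]
      simp only [Measure.smul_apply, ENNReal.smul_def, smul_eq_mul, Finset.prod_mul_distrib,
        ENNReal.ofNNReal_finsetProd]
  rw [← h1]
  refine Measure.le_iff.2 fun s hs => ?_
  rw [Measure.pi_def (fun i => C i • ν i), toMeasure_apply _ _ hs]
  refine (OuterMeasure.le_pi (n := (Measure.pi μ).toOuterMeasure)).2 (fun t _ => ?_) s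
  change Measure.pi μ (Set.univ.pi t) ≤ _
  rw [Measure.pi_pi]
  exact Finset.prod_le_prod' fun i _ => h i (t i)

/-- Change of variables, as an inequality, in a product of measures. -/
lemma lintegral_pi_le_of_restrict_le {Z : ι → Type*} [∀ i, MeasurableSpace (Z i)]
    {μ : ∀ i, Measure (Y i)} [∀ i, IsFiniteMeasure (μ i)] {ν : ∀ i, Measure (Z i)}
    [∀ i, SigmaFinite (ν i)] {U : ∀ i, Set (Y i)} {B : ∀ i, Set (Z i)}
    (hB : ∀ i, ν i (B i) ≠ ⊤) {σ : ∀ i, Z i → Y i}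
    (hσ : ∀ i, AEMeasurable (σ i) ((ν i).restrict (B i))) {C : ι → NNReal}
    (h : ∀ i, (μ i).restrict (U i) ≤ C i • ((ν i).restrict (B i)).map (σ i))
    {F : (∀ i, Y i) → ENNReal} (hF : Measurable F) :
    ∫⁻ x in Set.univ.pi U, F x ∂(Measure.pi μ) ≤
      (∏ i, C i : NNReal) * ∫⁻ z in Set.univ.pi B, F (fun i => σ i (z i)) ∂(Measure.pi ν) := by
  have : ∀ i, IsFiniteMeasure ((ν i).restrict (B i)) := fun i => ⟨by simpa using (hB i).lt_top⟩
  have h1 := Measure.pi_le_smul_pi h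
  rw [← Measure.pi_map_pi hσ, ← Measure.restrict_pi_pi, ← Measure.restrict_pi_pi] at h1
  refine (lintegral_mono' h1 le_rfl).trans_eq ?_
  rw [lintegral_smul_measure, lintegral_map' hF.aemeasurable, ENNReal.smul_def, smul_eq_mul]
  rw [Measure.restrict_pi_pi]
  exact aemeasurable_pi_lambda _ fun i =>
    (hσ i).comp_quasiMeasurePreserving (Measure.quasiMeasurePreserving_eval _ i)

end ProductMeasures

/-! ### Bounded densities read in charts -/

section ChartMeasure

open Measure in
/-- Near a point, a measure with bounded density on a submanifold is dominated by a multiple of the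
Lebesgue measure in a chart. -/
theorem IsC2Chart.exists_restrict_le {N d : ℕ} {X : Set (Euc N)}
    {ψ : OpenPartialHomeomorph X (Euc d)} (hψ : IsC2Chart X ψ) {x : X} (hx : x ∈ ψ.source)
    {μ : Measure X} (hμ : HasBoundedDensity μ (hausdorffMeasure (d : ℝ))) :
    ∃ ρ > 0, Metric.ball (ψ x) ρ ⊆ ψ.target ∧ ∃ C : NNReal, ∀ r ≤ ρ,
      μ.restrict (ψ.symm '' Metric.ball (ψ x) r) ≤
        C • (volume.restrict (Metric.ball (ψ x) r)).map ψ.symm := by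
  have htar : ψ.target ∈ nhds (ψ x) := ψ.open_target.mem_nhds (ψ.map_source hx)
  -- The inverse chart is locally `K`-Lipschitz, so it multiplies `d`-dimensional Hausdorff measure
  -- by at most `K ^ d`.
  obtain ⟨K, s, hs, hK⟩ :=
    ContDiffAt.exists_lipschitzOnWith ((hψ.1.contDiffAt htar).of_le (by norm_num))
  obtain ⟨ρ, hρ, hball⟩ := Metric.mem_nhds_iff.1 (Filter.inter_mem hs htar)
  have hLip : LipschitzOnWith K ψ.symm (Metric.ball (ψ x) ρ) := fun y hy z hz =>
    hK (hball hy).1 (hball hz).1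
  obtain ⟨f, hf, hfM, rfl⟩ := hμ
  set M := essSup f (hausdorffMeasure (d : ℝ) : Measure X)
  have hμM : (hausdorffMeasure (d : ℝ) : Measure X).withDensity f ≤
      M • (hausdorffMeasure (d : ℝ) : Measure X) := by
    rw [← withDensity_const]
    exact withDensity_mono ae_le_essSup
  have : (hausdorffMeasure (d : ℝ) : Measure (Euc d)).IsAddHaarMeasure := by
    have := isAddHaarMeasure_hausdorffMeasure (E := Euc d)
    rwa [finrank_euclideanSpace_fin] at this
  have hH := isAddLeftInvariant_eq_smul (hausdorffMeasure (d : ℝ) : Measure (Euc d)) volume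
  set c := addHaarScalarFactor (hausdorffMeasure (d : ℝ) : Measure (Euc d)) volume
  refine ⟨ρ, hρ, fun y hy => (hball hy).2, M.toNNReal * (K ^ d * c), fun r hr => ?_⟩
  have hrρ := Metric.ball_subset_ball hr (x := ψ x)
  have hmeas : AEMeasurable ψ.symm (volume.restrict (Metric.ball (ψ x) r)) :=
    (hLip.continuousOn.mono hrρ).aemeasurable measurableSet_ball
  refine le_iff.2 fun t ht => ?_
  rw [restrict_apply ht, Measure.smul_apply, map_apply_of_aemeasurable hmeas ht,
    restrict_apply' measurableSet_ball]
  set A := ψ.symm ⁻¹' t ∩ Metric.ball (ψ x) r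
  have hsub : t ∩ ψ.symm '' Metric.ball (ψ x) r ⊆ ψ.symm '' A := by
    rintro _ ⟨h1, y, hy, rfl⟩
    exact ⟨y, ⟨h1, hy⟩, rfl⟩
  have hAρ : A ⊆ Metric.ball (ψ x) ρ := Set.inter_subset_right.trans hrρ
  calc (hausdorffMeasure (d : ℝ) : Measure X).withDensity f (t ∩ ψ.symm '' Metric.ball (ψ x) r)
      ≤ M * hausdorffMeasure (d : ℝ) (ψ.symm '' A) :=
        (hμM _).trans (mul_le_mul_right (measure_mono hsub) _)
    _ ≤ M * ((K : ENNReal) ^ d * hausdorffMeasure (d : ℝ) A) := by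
        gcongr
        have := (hLip.mono hAρ).hausdorffMeasure_image_le (d := d) (by positivity)
        rwa [ENNReal.rpow_natCast] at this
    _ = (M.toNNReal * (K ^ d * c)) • volume A := by
        rw [hH, Measure.smul_apply, ENNReal.smul_def, ENNReal.smul_def, ENNReal.coe_mul, ENNReal.coe_mul,
          ENNReal.coe_toNNReal hfM.ne, ENNReal.coe_pow, smul_eq_mul, smul_eq_mul, mul_assoc,
          mul_assoc]

end ChartMeasure

/-! ### Localisation, compactness and conclusion -/

section Assembly

variable {m N : ℕ} {X : Fin m → Set (Euc N)} {d : Fin m → ℕ}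

lemma IsC2Cost.continuous {c : (∀ i, X i) → ℝ} (hc : IsC2Cost d c)
    (hX : ∀ i, IsC2Submanifold (X i) (d i)) : Continuous c := by
  refine continuous_iff_continuousAt.2 fun x => ?_
  choose ψ hψ hx using fun i => hX i (x i)
  have h1 : ContinuousAt (inCharts c ψ) fun i => ψ i (x i) := (hc.contDiffAt hψ hx).continuousAt
  have h2 : ContinuousAt (fun z : ∀ i, X i => fun i => ψ i (z i)) x :=
    continuousAt_pi.2 fun i => ((ψ i).continuousAt (hx i)).comp (continuousAt_apply i x)
  refine (h1.comp_of_eq h2 rfl).congr ?_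
  filter_upwards [(isOpen_set_pi Set.finite_univ fun i _ => (ψ i).open_source).mem_nhds
    fun i _ => hx i] with z hz
  exact congrArg c (funext fun i => (ψ i).left_inv (hz i trivial))

/-- Local form of the estimate of the Laplace integrals of the gaps. -/
lemma exists_nhds_lintegral_gap_le {μ : ∀ i, Measure (X i)} [∀ i, IsProbabilityMeasure (μ i)]
    (hμ : ∀ i, HasBoundedDensity (μ i) (Measure.hausdorffMeasure (d i : ℝ)))
    {K : ∀ i, Set (X i)} (hK : ∀ i, IsCompact (K i)) {c : (∀ i, X i) → ℝ} (hcont : Continuous c)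
    (hc : IsC2Cost d c) {κ : ℕ} (hκ : PosSignature d c κ) (x : ∀ i, X i) :
    ∃ U ∈ nhds x, ∃ C : ℝ, 0 ≤ C ∧ ∀ (a : ℝ) (φ : ∀ i, X i → ℝ), (∀ i, Measurable (φ i)) →
      (∀ z ∈ Set.univ.pi K, a + ∑ i, φ i (z i) ≤ c z) → ∀ ε : ℝ, 0 < ε →
      ∫⁻ z in U ∩ Set.univ.pi K, ENNReal.ofReal (Real.exp (-(c z - (a + ∑ i, φ i (z i))) / ε))
        ∂(Measure.pi μ) ≤ ENNReal.ofReal (C * ε ^ ((κ : ℝ) / 2)) := by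
  obtain ⟨ψ, hψ, g, hg, hκg⟩ := hκ x
  obtain ⟨T, hT, lam, hlam, ρ, hρ, hcoer⟩ :=
    exists_gap_coercive (hc.contDiffAt (fun i => (hψ i).1) fun i => (hψ i).2) hg hκg
  choose R hR hRt C hC using fun i => (hψ i).1.exists_restrict_le (hψ i).2 (hμ i)
  obtain ⟨r, hrR, hrρ, hr⟩ : ∃ r : ℝ, (∀ i, r ≤ R i) ∧ r ≤ ρ ∧ 0 < r := by
    have h1 : ∀ s : ℝ, 0 < s → ∀ᶠ r in nhdsWithin (0 : ℝ) (Set.Ioi 0), r ≤ s := fun s hs =>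
      nhdsWithin_le_nhds (Iic_mem_nhds hs)
    exact ((Filter.eventually_all.2 fun i => h1 _ (hR i)).and
      ((h1 ρ hρ).and self_mem_nhdsWithin)).exists
  set B : ∀ i, Set (Euc (d i)) := fun i => Metric.ball (ψ i (x i)) r with hB
  have hBt : ∀ i, B i ⊆ (ψ i).target := fun i =>
    (Metric.ball_subset_ball (hrR i)).trans (hRt i)
  -- The gap is known to be nonnegative only over `K`; this set remains a product, as coercivity
  -- requires.
  set S : ∀ i, Set (Euc (d i)) := fun i => B i ∩ (ψ i).symm ⁻¹' K i with hS
  have hBbd : Bornology.IsBounded (Set.univ.pi B) := by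
    rw [hB, ← ball_pi _ hr]
    exact Metric.isBounded_ball
  obtain ⟨C', hC'⟩ := exists_lintegral_exp_neg_le (volume : Measure (∀ i, Euc (d i))) hT hlam hBbd
  refine ⟨Set.univ.pi fun i => (ψ i).symm '' B i,
    (isOpen_set_pi Set.finite_univ fun i _ =>
      (ψ i).symm.isOpen_image_of_subset_source Metric.isOpen_ball (hBt i)).mem_nhds
      fun i _ => ⟨ψ i (x i), Metric.mem_ball_self hr, (ψ i).left_inv (hψ i).2⟩,
    (∏ i, C i : NNReal) * max C' 0, by positivity, fun a φ hφ hle ε hε => ?_⟩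
  set f : (∀ i, X i) → ENNReal :=
    fun z => ENNReal.ofReal (Real.exp (-(c z - (a + ∑ i, φ i (z i))) / ε)) with hf
  have hfm : Measurable f := by
    have := hcont.measurable
    have : ∀ i, Measurable fun x : ∀ i, X i => φ i (x i) := fun i =>
      (hφ i).comp (measurable_pi_apply i)
    fun_prop
  have hKm : MeasurableSet (Set.univ.pi K) := MeasurableSet.univ_pi fun i => (hK i).measurableSet
  have hmeas : ∀ i, AEMeasurable (ψ i).symm (volume.restrict (B i)) := fun i =>
    ((ψ i).continuousOn_symm.mono (hBt i)).aemeasurable measurableSet_ball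
  have h1 := lintegral_pi_le_of_restrict_le (μ := μ) (ν := fun _ => volume)
    (fun i => measure_ball_lt_top.ne) hmeas (fun i => hC i r (hrR i)) (hfm.indicator hKm)
  rw [lintegral_indicator hKm, Measure.restrict_restrict hKm, Set.inter_comm] at h1
  refine h1.trans ?_
  set e : (∀ i, Euc (d i)) → ℝ :=
    fun y => inCharts c ψ y - (a + ∑ i, φ i ((ψ i).symm (y i))) with he
  have hle' : ∀ y ∈ Set.univ.pi S, a + ∑ i, φ i ((ψ i).symm (y i)) ≤ inCharts c ψ y :=
    fun y hy => hle _ fun i _ => (hy i trivial).2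
  have h2 := hC' (Set.univ.pi S) (Set.pi_mono fun i _ => Set.inter_subset_left) e
    (fun y hy => sub_nonneg.2 (hle' y hy))
    (hcoer S (fun i => Set.inter_subset_left.trans (Metric.ball_subset_ball hrρ)) a
      (fun i y => φ i ((ψ i).symm y)) hle') ε hε
  rw [← lintegral_indicator (MeasurableSet.univ_pi fun i => measurableSet_ball), mul_assoc,
    ENNReal.ofReal_mul NNReal.zero_le_coe, ENNReal.ofReal_coe_nnreal]
  gcongr
  refine le_trans (lintegral_mono fun y => ?_) (h2.trans (ENNReal.ofReal_le_ofReal (by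
    gcongr
    exact le_max_left _ _)))
  by_cases hy : y ∈ Set.univ.pi S
  · have hyB : y ∈ Set.univ.pi B := fun i _ => (hy i trivial).1
    have hyK : (fun i => (ψ i).symm (y i)) ∈ Set.univ.pi K := fun i _ => (hy i trivial).2
    rw [Set.indicator_of_mem hy, Set.indicator_of_mem hyB, Set.indicator_of_mem hyK]
    exact le_rfl
  · refine le_of_eq_of_le ?_ zero_le
    by_cases hyB : y ∈ Set.univ.pi B
    · rw [Set.indicator_of_mem hyB]
      exact Set.indicator_of_notMem (fun h : (fun i => (ψ i).symm (y i)) ∈ Set.univ.pi K =>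
        hy fun i _ => ⟨hyB i trivial, h i trivial⟩) _
    · exact Set.indicator_of_notMem hyB _

/-- The lower bound for the entropic cost under the signature condition. -/
theorem PosSignature.MOT_add_le_entropicMOT {μ : ∀ i, Measure (X i)}
    [∀ i, IsProbabilityMeasure (μ i)] (hX : ∀ i, IsC2Submanifold (X i) (d i))
    (hcpt : ∀ i, ∃ K : Set (X i), IsCompact K ∧ μ i Kᶜ = 0)
    (hμ : ∀ i, HasBoundedDensity (μ i) (Measure.hausdorffMeasure (d i : ℝ)))
    {c : (∀ i, X i) → ℝ} (hc : IsC2Cost d c) {κ : ℕ} (hκ : PosSignature d c κ) :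
    ∃ C : ℝ, 0 ≤ C ∧ ∀ ε : ℝ, 0 < ε →
      MOT μ c + (((κ : ℝ) / 2 * ε * Real.log (1 / ε) - C * ε : ℝ) : EReal)
        ≤ entropicMOT ε μ c := by
  choose K hK hμK using hcpt
  have hcont := hc.continuous hX
  obtain ⟨C, hC, h⟩ : ∃ C : ℝ, 0 ≤ C ∧ ∀ (a : ℝ) (φ : ∀ i, X i → ℝ), (∀ i, Measurable (φ i)) →
      (∀ z ∈ Set.univ.pi K, a + ∑ i, φ i (z i) ≤ c z) → ∀ ε : ℝ, 0 < ε →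
      ∫⁻ z in Set.univ.pi K ∩ Set.univ.pi K,
        ENNReal.ofReal (Real.exp (-(c z - (a + ∑ i, φ i (z i))) / ε)) ∂(Measure.pi μ) ≤
        ENNReal.ofReal (C * ε ^ ((κ : ℝ) / 2)) := by
    -- A bound uniform in the potentials and in `ε` is stable under finite unions, the constants
    -- adding up.
    refine (isCompact_univ_pi hK).induction_on (p := fun s => ∃ C : ℝ, 0 ≤ C ∧
      ∀ (a : ℝ) (φ : ∀ i, X i → ℝ), (∀ i, Measurable (φ i)) →
      (∀ z ∈ Set.univ.pi K, a + ∑ i, φ i (z i) ≤ c z) → ∀ ε : ℝ, 0 < ε →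
      ∫⁻ z in s ∩ Set.univ.pi K,
        ENNReal.ofReal (Real.exp (-(c z - (a + ∑ i, φ i (z i))) / ε)) ∂(Measure.pi μ) ≤
        ENNReal.ofReal (C * ε ^ ((κ : ℝ) / 2))) ?_ ?_ ?_ ?_
    · exact ⟨0, le_rfl, by simp⟩
    · rintro s t hst ⟨C, hC, h⟩
      exact ⟨C, hC, fun a φ hφ hle ε hε =>
        (lintegral_mono_set (Set.inter_subset_inter_left _ hst)).trans (h a φ hφ hle ε hε)⟩
    · rintro s t ⟨C, hC, h⟩ ⟨C', hC', h'⟩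
      refine ⟨C + C', by positivity, fun a φ hφ hle ε hε => ?_⟩
      rw [Set.union_inter_distrib_right, add_mul, ENNReal.ofReal_add (by positivity)
        (by positivity)]
      exact (lintegral_union_le _ _ _).trans (add_le_add (h a φ hφ hle ε hε) (h' a φ hφ hle ε hε))
    · intro x _
      obtain ⟨U, hU, h⟩ := exists_nhds_lintegral_gap_le hμ hK hcont hc hκ x
      exact ⟨U, mem_nhdsWithin_of_mem_nhds hU, h⟩
  -- Adding `1` makes the constant strictly positive, since its logarithm is taken.
  refine _root_.MOT_add_le_entropicMOT hK hμK hcont (B := C + 1) (by positivity)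
    fun a φ hφ hle ε hε => ?_
  have h1 := h a φ hφ hle ε hε
  rw [Set.inter_self] at h1
  refine h1.trans (ENNReal.ofReal_le_ofReal ?_)
  gcongr
  linarith

/-- For two marginals, the rank of `D²_{x₁x₂} c` bounds the signature from below. -/
theorem posSignature_of_le_rank {X : Fin 2 → Set (Euc N)} {d : Fin 2 → ℕ} {c : (∀ i, X i) → ℝ}
    (hc : IsC2Cost d c) {r : ℕ}
    (hr : ∀ x : ∀ i, X i, ∃ ψ : ∀ i, OpenPartialHomeomorph (X i) (Euc (d i)),
      (∀ i, IsC2Chart (X i) (ψ i) ∧ x i ∈ (ψ i).source) ∧ r ≤ (mixedHessian c ψ x 0 1).rank) :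
    PosSignature d c r := fun x => by
  obtain ⟨ψ, hψ, hle⟩ := hr x
  exact ⟨ψ, hψ, passForm c ψ x {0}, subset_convexHull ℝ _ ⟨{0}, by simp, ⟨1, by simp⟩, rfl⟩,
    hle.trans (rank_mixedHessian_le_posEigenvalues
      (hc.contDiffAt (fun i => (hψ i).1) fun i => (hψ i).2))⟩

end Assembly

theorem mainTheorem3 :
    (∀ (m N : ℕ) (X : Fin m → Set (Euc N)) (d : Fin m → ℕ)
        (μ : ∀ i, Measure (X i)) (c : (∀ i, X i) → ℝ) (κ : ℕ),
      (∀ i, IsC2Submanifold (X i) (d i)) →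
      (∀ i, IsProbabilityMeasure (μ i)) →
      (∀ i, ∃ K : Set (X i), IsCompact K ∧ μ i Kᶜ = 0) →
      (∀ i, HasBoundedDensity (μ i) (Measure.hausdorffMeasure (d i : ℝ))) →
      IsC2Cost d c →
      PosSignature d c κ →
      ∃ C : ℝ, 0 ≤ C ∧ ∀ ε : ℝ, 0 < ε →
        MOT μ c + (((κ : ℝ) / 2 * ε * Real.log (1 / ε) - C * ε : ℝ) : EReal)
          ≤ entropicMOT ε μ c) ∧
    (∀ (N : ℕ) (X : Fin 2 → Set (Euc N)) (d : Fin 2 → ℕ)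
        (μ : ∀ i, Measure (X i)) (c : (∀ i, X i) → ℝ) (r : ℕ),
      (∀ i, IsC2Submanifold (X i) (d i)) →
      (∀ i, IsProbabilityMeasure (μ i)) →
      (∀ i, ∃ K : Set (X i), IsCompact K ∧ μ i Kᶜ = 0) →
      (∀ i, HasBoundedDensity (μ i) (Measure.hausdorffMeasure (d i : ℝ))) →
      IsC2Cost d c →
      (∀ x : ∀ i, X i, ∃ ψ : ∀ i, OpenPartialHomeomorph (X i) (Euc (d i)),
        (∀ i, IsC2Chart (X i) (ψ i) ∧ x i ∈ (ψ i).source) ∧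
          r ≤ (mixedHessian c ψ x 0 1).rank) →
      PosSignature d c r ∧
      ∃ C : ℝ, 0 ≤ C ∧ ∀ ε : ℝ, 0 < ε →
        MOT μ c + (((r : ℝ) / 2 * ε * Real.log (1 / ε) - C * ε : ℝ) : EReal)
          ≤ entropicMOT ε μ c) := by
  refine ⟨fun m N X d μ c κ hX hμp hcpt hμ hc hκ => hκ.MOT_add_le_entropicMOT hX hcpt hμ hc,
    fun N X d μ c r hX hμp hcpt hμ hc hr => ?_⟩
  have hκ := posSignature_of_le_rank hc hr
  exact ⟨hκ, hκ.MOT_add_le_entropicMOT hX hcpt hμ hc⟩
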